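/- Let $R$ be an associative ring with identity, equipped with a pseudo-involution, i.e. an additive map $a\mapsto\overline a$ such that $\overline1$ is invertible, $\overline{\overline a}=a$ and $\overline{ab}=\overline b\,\overline1^{-1}\overline a$ for all $a,b\in R$. Let $V$ be a right $R$-module with an anti-Hermitian form $B$, i.e. a biadditive map $B:V\times V\to R$ with $B(ua,vb)=\overline a\,\overline1^{-1}B(u,v)b$ and $B(u,v)=-\overline{B(v,u)}$. Its Heisenberg group is the set $V\times R$ with the operation $(u,a)\dotplus(v,b)=(u+v,\,a+b+B(u,v))$, on which $R$ acts from the right by $(u,a)\leftharpoonup b=(ub,\ \overline b\,\overline1^{-1}ab)$. Let $\mathfrak L$ be an odd form parameter, i.e. a subgroup of the Heisenberg group, stable under this action, with $$\{(0,a+\overline a)\mid a\in R\}\subseteq\mathfrak L\subseteq\{(u,a)\mid a=\overline a+B(u,u)\}.$$ For an integer $n\ge3$ let $\Omega=\{1,\dots,n,-n,\dots,-1\}$, and put $\varepsilon_i=\overline1^{-1}$ for $i>0$ and $\varepsilon_i=-1$ for $i<0$. The odd unitary Steinberg group $\mathrm{StU}(2n,R,\mathfrak L)$ is the group with generators $X_{ij}(a)$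 ($i,j\in\Omega$, $i\ne\pm j$, $a\in R$) and $X_i(\xi)$ ($i\in\Omega$, $\xi\in\mathfrak L$) and the following relations, imposed whenever all generators in them are defined, where $[x,y]=xyx^{-1}y^{-1}$: - (R0) $X_{ij}(a)=X_{-j,-i}(\varepsilon_{-j}\overline a\varepsilon_i)$; - (R1) $X_{ij}(a)X_{ij}(b)=X_{ij}(a+b)$; - (R2) $X_i(\xi)X_i(\zeta)=X_i(\xi\dotplus\zeta)$; - (R3) $[X_{ij}(a),X_{hk}(b)]=1$ for $h\notin\{j,-i\}$, $k\notin\{i,-j\}$; - (R4) $[X_i(\xi),X_{jk}(a)]=1$ for $j\ne-i$, $k\ne i$; - (R5) $[X_{ij}(a),X_{jk}(b)]=X_{ik}(ab)$; - (R6) $[X_i(u,a),X_j(v,b)]=X_{i,-j}(\varepsilon_iB(u,v))$ for $i\ne\pm j$; - (R7) $[X_i(u,a),X_i(v,b)]=X_i(0,\,B(u,v)-B(v,u))$; - (R8) $[X_i(u,a),X_{-i,j}(b)]=X_{ij}(\varepsilon_iab)\,X_{-j}((u,-\overline a)\leftharpoonup b)$; - (R9) $[X_{ij}(a),X_{j,-i}(b)]=X_i(0,\,-\varepsilon_{-i}\overline1ab+\overline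 b\,\overline1^{-1}\overline a\varepsilon_i)$. Let $\mathrm{StU}(\infty,R,\mathfrak L)$ be the direct limit of the groups $\mathrm{StU}(2n,R,\mathfrak L)$, $n\ge3$, along the homomorphisms that send $X_{ij}(a)$ to $X_{ij}(a)$ and $X_i(\xi)$ to $X_i(\xi)$; for $n=\infty$ the index set $\Omega$ is the set of all non-zero integers, and $X_{ij}(a)$ also denotes its image in the limit. **Main lemma.** Let $n\ge4$ be an integer or $n=\infty$ (with $2\infty=\infty$), and let $\epsilon:H\to\mathrm{StU}(2n,R,\mathfrak L)$ be a central extension, i.e. a surjective group homomorphism whose kernel is contained in the centre of $H$. Suppose that for all $a,b\in R$ and all $i,j,k,h\in\Omega$ for which the set $\{i,-i,j,-j,k,-k,h,-h\}$ has exactly eight elements, any $x,y\in H$ with $\epsilon(x)=X_{ij}(a)$ and $\epsilon(y)=X_{kh}(b)$ commute. Then $\epsilon$ splits: there is a group homomorphism $\sigma:\mathrm{StU}(2n,R,\mathfrak L)\to H$ with $\epsilon\circ\sigma=\mathrm{id}$. -/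

import Mathlib

open scoped RightActions commutatorElement

namespace OddUnitary

universe u v w

/-- A pseudo-involution `a ↦ ā` on an associative unital ring `R`: an additive map such that
`1̄` is invertible, `a` is the double conjugate of `a`, and the conjugate of `a * b` is
`b̄ * 1̄⁻¹ * ā`. The unit `oneBar` is `1̄`. -/
structure PseudoInvolution (R : Type u) [Ring R] where
  bar : R →+ R
  oneBar : Rˣ
  bar_one : bar 1 = oneBar
  bar_bar : ∀ a, bar (bar a) = a
  bar_mul : ∀ a b, bar (a * b) = bar b * (↑oneBar⁻¹ : R) * bar a

section Form

variable {R : Type u} [Ring R]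

/-- An anti-Hermitian form on a right `R`-module `V` (right modules are modules over `Rᵐᵒᵖ`,
and `x <• a` is the right action). -/
structure AntiHermitianForm (J : PseudoInvolution R) (V : Type v) [AddCommGroup V]
    [Module Rᵐᵒᵖ V] where
  toFun : V →+ V →+ R
  map_smul : ∀ (x y : V) (a b : R),
    toFun (x <• a) (y <• b) = J.bar a * (↑J.oneBar⁻¹ : R) * toFun x y * b
  anti : ∀ x y : V, toFun x y = -J.bar (toFun y x)

variable {J : PseudoInvolution R} {V : Type v} [AddCommGroup V] [Module Rᵐᵒᵖ V]

instance : CoeFun (AntiHermitianForm J V) (fun _ => V → V →+ R) :=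
  ⟨fun B => B.toFun⟩

/-- The Heisenberg group of the form `B`: the set `V × R` with the (in general noncommutative)
composition law `(x, a) ∔ (y, b) = (x + y, a + b + B x y)`, written additively. -/
@[ext]
structure Heisenberg (B : AntiHermitianForm J V) where
  vec : V
  scal : R

namespace Heisenberg

variable {B : AntiHermitianForm J V}

instance : Zero (Heisenberg B) := ⟨⟨0, 0⟩⟩

instance : Add (Heisenberg B) := ⟨fun p q => ⟨p.vec + q.vec, p.scal + q.scal + B p.vec q.vec⟩⟩

instance : Neg (Heisenberg B) := ⟨fun p => ⟨-p.vec, -p.scal + B p.vec p.vec⟩⟩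

@[simp] theorem zero_vec : (0 : Heisenberg B).vec = 0 := rfl
@[simp] theorem zero_scal : (0 : Heisenberg B).scal = 0 := rfl
@[simp] theorem add_vec (p q : Heisenberg B) : (p + q).vec = p.vec + q.vec := rfl
@[simp] theorem add_scal (p q : Heisenberg B) :
    (p + q).scal = p.scal + q.scal + B p.vec q.vec := rfl
@[simp] theorem neg_vec (p : Heisenberg B) : (-p).vec = -p.vec := rfl
@[simp] theorem neg_scal (p : Heisenberg B) : (-p).scal = -p.scal + B p.vec p.vec := rfl

instance : AddGroup (Heisenberg B) :=
  AddGroup.ofLeftAxioms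
    (fun p q r => by ext <;> simp [add_assoc]; abel)
    (fun p => by ext <;> simp)
    (fun p => by ext <;> simp)

/-- The right action `(x, a) ↼ b = (x b, b̄ 1̄⁻¹ a b)` of `R` on the Heisenberg group. -/
def act (p : Heisenberg B) (b : R) : Heisenberg B :=
  ⟨p.vec <• b, J.bar b * (↑J.oneBar⁻¹ : R) * p.scal * b⟩

end Heisenberg

/-- The minimal odd form parameter `{(0, a + ā)}`. -/
def formMin (B : AntiHermitianForm J V) : Set (Heisenberg B) :=
  {p | ∃ a : R, p = ⟨0, a + J.bar a⟩}

/-- The maximal odd form parameter `{(x, a) | a = ā + B x x}`. -/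
def formMax (B : AntiHermitianForm J V) : Set (Heisenberg B) :=
  {p | p.scal = J.bar p.scal + B p.vec p.vec}

/-- An odd form parameter: a subgroup of the Heisenberg group that lies between the minimal and
the maximal ones and is stable under the right action of `R`. A triple `(V, B, 𝔏)` with `𝔏` an odd
form parameter is an odd quadratic space. -/
structure OddFormParameter (B : AntiHermitianForm J V) extends AddSubgroup (Heisenberg B) where
  formMin_le : formMin B ⊆ carrier
  le_formMax : carrier ⊆ formMax B
  act_mem : ∀ p ∈ carrier, ∀ b : R, p.act b ∈ carrier

/-- The set of indices `Ω = {1, …, n, -n, …, -1}`. -/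
def Idx (n : ℕ) : Type := {i : ℤ // i ≠ 0 ∧ i.natAbs ≤ n}

instance (n : ℕ) : DecidableEq (Idx n) := inferInstanceAs (DecidableEq (Subtype _))

instance (n : ℕ) : Neg (Idx n) := ⟨fun i => ⟨-i.1, by simpa using i.2⟩⟩

/-- The inclusion of index sets. -/
def Idx.incl {m n : ℕ} (h : m ≤ n) (i : Idx m) : Idx n := ⟨i.1, i.2.1, i.2.2.trans h⟩

/-- `ε_i = 1̄⁻¹` for positive `i` and `ε_i = -1` for negative `i`. -/
def sgn (J : PseudoInvolution R) {n : ℕ} (i : Idx n) : R :=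
  if 0 < i.1 then (↑J.oneBar⁻¹ : R) else -1

theorem PseudoInvolution.bar_oneBar (J : PseudoInvolution R) : J.bar (J.oneBar : R) = 1 := by
  rw [← J.bar_one, J.bar_bar]

namespace OddFormParameter

variable {B : AntiHermitianForm J V} (L : OddFormParameter B)

theorem trace_mem (c : R) : (⟨0, c + J.bar c⟩ : Heisenberg B) ∈ L.toAddSubgroup :=
  L.formMin_le ⟨c, rfl⟩

/-- If `(x, a) ∈ 𝔏` then `(x, -ā) ∈ 𝔏`. -/
theorem conj_mem (ξ : L.toAddSubgroup) :
    (⟨ξ.1.vec, -J.bar ξ.1.scal⟩ : Heisenberg B) ∈ L.toAddSubgroup := by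
  have h1 : (-ξ.1).act (-1) ∈ L.toAddSubgroup := L.act_mem _ (neg_mem ξ.2) _
  have h2 : ξ.1.scal = J.bar ξ.1.scal + B ξ.1.vec ξ.1.vec := L.le_formMax ξ.2
  have h3 : (-ξ.1).act (-1) = (⟨ξ.1.vec, -J.bar ξ.1.scal⟩ : Heisenberg B) := by
    ext
    · simp [Heisenberg.act]
    · simp only [Heisenberg.act, map_neg, J.bar_one, Heisenberg.neg_scal]
      simp only [neg_mul, Units.mul_inv, one_mul, mul_neg, mul_one, neg_neg]
      rw [neg_add_eq_iff_eq_add, ← sub_eq_add_neg, eq_sub_iff_add_eq, add_comm]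
      exact h2.symm
  rwa [h3] at h1

/-- The element `(0, B x y - B y x)` of `𝔏`. -/
theorem comm_mem (x y : V) : (⟨0, B x y - B y x⟩ : Heisenberg B) ∈ L.toAddSubgroup := by
  have h := L.trace_mem (B x y)
  rwa [show B x y - B y x = B x y + J.bar (B x y) by rw [B.anti y x, sub_neg_eq_add]]

/-- The element `(0, -ε_{-i} 1̄ a b + b̄ 1̄⁻¹ ā ε_i)` of `𝔏`. -/
theorem short_mem {n : ℕ} (i : Idx n) (a b : R) :
    (⟨0, -(sgn J (-i) * J.oneBar * a * b) +
      J.bar b * (↑J.oneBar⁻¹ : R) * J.bar a * sgn J i⟩ : Heisenberg B) ∈ L.toAddSubgroup := by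
  have h := L.trace_mem (-(sgn J (-i) * J.oneBar * a * b))
  convert h using 3
  have hi := i.2.1
  have hn : (-i).1 = -i.1 := rfl
  by_cases hp : 0 < i.1
  · have hp' : ¬ 0 < -i.1 := by omega
    simp only [sgn, hn, hp, hp', if_true, if_false, neg_mul, one_mul, neg_neg]
    simp [J.bar_mul, J.bar_oneBar, mul_assoc]
  · have hp' : 0 < -i.1 := by omega
    simp only [sgn, hn, hp, hp', J.bar_mul, if_true, if_false, Units.inv_mul, one_mul, map_neg]
    simp

end OddFormParameter

variable {B : AntiHermitianForm J V}

/-- The generators `X_ij(a)` (`i ≠ ±j`, `a ∈ R`) and `X_i(ξ)` (`ξ ∈ 𝔏`). -/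
inductive Gen (L : OddFormParameter B) (n : ℕ) : Type (max u v)
  | long (i j : Idx n) (hij : i ≠ j ∧ i ≠ -j) (a : R) : Gen L n
  | short (i : Idx n) (ξ : L.toAddSubgroup) : Gen L n

/-- The letter `X_ij(a)` of the free group. -/
def gl (L : OddFormParameter B) {n : ℕ} (i j : Idx n) (hij : i ≠ j ∧ i ≠ -j) (a : R) :
    FreeGroup (Gen L n) := FreeGroup.of (Gen.long i j hij a)

/-- The letter `X_i(ξ)` of the free group. -/
def gs (L : OddFormParameter B) {n : ℕ} (i : Idx n) (ξ : L.toAddSubgroup) :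
    FreeGroup (Gen L n) := FreeGroup.of (Gen.short i ξ)

/-- The Steinberg relations: `Rel L n x y` is the relation `x = y`. In each relation all the
generators that occur are assumed to be defined. Here `⁅x, y⁆ = x * y * x⁻¹ * y⁻¹`. -/
inductive Rel (L : OddFormParameter B) (n : ℕ) : FreeGroup (Gen L n) → FreeGroup (Gen L n) → Prop
  | r0 (i j : Idx n) (hij : i ≠ j ∧ i ≠ -j) (hji : -j ≠ -i ∧ -j ≠ -(-i)) (a : R) :
      Rel L n (gl L i j hij a) (gl L (-j) (-i) hji (sgn J (-j) * J.bar a * sgn J i))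
  | r1 (i j : Idx n) (hij : i ≠ j ∧ i ≠ -j) (a b : R) :
      Rel L n (gl L i j hij a * gl L i j hij b) (gl L i j hij (a + b))
  | r2 (i : Idx n) (ξ ζ : L.toAddSubgroup) :
      Rel L n (gs L i ξ * gs L i ζ) (gs L i (ξ + ζ))
  | r3 (i j h k : Idx n) (hij : i ≠ j ∧ i ≠ -j) (hhk : h ≠ k ∧ h ≠ -k)
      (h1 : h ≠ j ∧ h ≠ -i) (h2 : k ≠ i ∧ k ≠ -j) (a b : R) :
      Rel L n ⁅gl L i j hij a, gl L h k hhk b⁆ 1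
  | r4 (i j k : Idx n) (hjk : j ≠ k ∧ j ≠ -k) (h1 : j ≠ -i) (h2 : k ≠ i)
      (ξ : L.toAddSubgroup) (a : R) :
      Rel L n ⁅gs L i ξ, gl L j k hjk a⁆ 1
  | r5 (i j k : Idx n) (hij : i ≠ j ∧ i ≠ -j) (hjk : j ≠ k ∧ j ≠ -k) (hik : i ≠ k ∧ i ≠ -k)
      (a b : R) :
      Rel L n ⁅gl L i j hij a, gl L j k hjk b⁆ (gl L i k hik (a * b))
  | r6 (i j : Idx n) (hij : i ≠ -j ∧ i ≠ -(-j)) (ξ ζ : L.toAddSubgroup) :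
      Rel L n ⁅gs L i ξ, gs L j ζ⁆ (gl L i (-j) hij (sgn J i * B ξ.1.vec ζ.1.vec))
  | r7 (i : Idx n) (ξ ζ : L.toAddSubgroup) :
      Rel L n ⁅gs L i ξ, gs L i ζ⁆ (gs L i
        ⟨⟨0, B ξ.1.vec ζ.1.vec - B ζ.1.vec ξ.1.vec⟩, L.comm_mem ξ.1.vec ζ.1.vec⟩)
  | r8 (i j : Idx n) (hij : i ≠ j ∧ i ≠ -j) (hij' : -i ≠ j ∧ -i ≠ -j)
      (ξ : L.toAddSubgroup) (b : R) :
      Rel L n ⁅gs L i ξ, gl L (-i) j hij' b⁆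
        (gl L i j hij (sgn J i * ξ.1.scal * b) *
          gs L (-j) ⟨Heisenberg.act ⟨ξ.1.vec, -J.bar ξ.1.scal⟩ b, L.act_mem _ (L.conj_mem ξ) b⟩)
  | r9 (i j : Idx n) (hij : i ≠ j ∧ i ≠ -j) (hji : j ≠ -i ∧ j ≠ -(-i)) (a b : R) :
      Rel L n ⁅gl L i j hij a, gl L j (-i) hji b⁆ (gs L i
        ⟨⟨0, -(sgn J (-i) * J.oneBar * a * b) +
          J.bar b * (↑J.oneBar⁻¹ : R) * J.bar a * sgn J i⟩, L.short_mem i a b⟩)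

/-- The relators `x * y⁻¹` of the Steinberg relations `x = y`. -/
def relators (L : OddFormParameter B) (n : ℕ) : Set (FreeGroup (Gen L n)) :=
  {r | ∃ x y, Rel L n x y ∧ r = x * y⁻¹}

/-- The odd unitary Steinberg group `StU(2n, R, 𝔏)` (of interest for `n ≥ 3`). Here `𝔏` is the odd
form parameter of the summand `V` of the odd hyperbolic unitary space `Hⁿ ⊕ V`. -/
abbrev StU (L : OddFormParameter B) (n : ℕ) : Type (max u v) := PresentedGroup (relators L n)

namespace StU

variable (L : OddFormParameter B)

/-- The element `X_ij(a)` of `StU(2n, R, 𝔏)`. -/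
def X {n : ℕ} (i j : Idx n) (hij : i ≠ j ∧ i ≠ -j) (a : R) : StU L n :=
  PresentedGroup.of (Gen.long i j hij a)

/-- The element `X_i(ξ)` of `StU(2n, R, 𝔏)`. -/
def Y {n : ℕ} (i : Idx n) (ξ : L.toAddSubgroup) : StU L n :=
  PresentedGroup.of (Gen.short i ξ)

theorem mk_eq_of_rel {n : ℕ} {x y : FreeGroup (Gen L n)} (h : Rel L n x y) :
    PresentedGroup.mk (relators L n) x = PresentedGroup.mk (relators L n) y :=
  PresentedGroup.mk_eq_mk_of_mul_inv_mem ⟨x, y, h, rfl⟩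

theorem incl_ne {m n : ℕ} (h : m ≤ n) {i j : Idx m} (hij : i ≠ j) : i.incl h ≠ j.incl h :=
  fun e => hij (Subtype.ext (congrArg (fun t : Idx n => t.1) e))

/-- `X_ij(a) ↦ X_ij(a)`, `X_i(ξ) ↦ X_i(ξ)` on generators. -/
def genMap {m n : ℕ} (h : m ≤ n) : Gen L m → StU L n
  | .long i j hij a => X L (i.incl h) (j.incl h) ⟨incl_ne h hij.1, incl_ne h (j := -j) hij.2⟩ a
  | .short i ξ => Y L (i.incl h) ξ

theorem genMap_rel {m n : ℕ} (h : m ≤ n) {x y : FreeGroup (Gen L m)} (hr : Rel L m x y) :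
    FreeGroup.lift (genMap L h) x = FreeGroup.lift (genMap L h) y := by
  cases hr with
  | r0 i j hij hji a =>
    exact mk_eq_of_rel L (Rel.r0 (i.incl h) (j.incl h) ⟨incl_ne h hij.1, incl_ne h (j := -j) hij.2⟩
      ⟨incl_ne h hji.1, incl_ne h hji.2⟩ a)
  | r1 i j hij a b =>
    exact
      mk_eq_of_rel L (Rel.r1 (i.incl h) (j.incl h)
        ⟨incl_ne h hij.1, incl_ne h (j := -j) hij.2⟩ a b)
  | r2 i ξ ζ =>
    exact mk_eq_of_rel L (Rel.r2 (i.incl h) ξ ζ)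
  | r3 i j k l hij hkl h1 h2 a b =>
    exact
      mk_eq_of_rel L (Rel.r3 (i.incl h) (j.incl h) (k.incl h) (l.incl h)
        ⟨incl_ne h hij.1, incl_ne h (j := -j) hij.2⟩ ⟨incl_ne h hkl.1, incl_ne h (j := -l) hkl.2⟩
        ⟨incl_ne h h1.1, incl_ne h (j := -i) h1.2⟩ ⟨incl_ne h h2.1, incl_ne h (j := -j) h2.2⟩ a b)
  | r4 i j k hjk h1 h2 ξ a =>
    exact
      mk_eq_of_rel L (Rel.r4 (i.incl h) (j.incl h) (k.incl h)
        ⟨incl_ne h hjk.1, incl_ne h (j := -k) hjk.2⟩ (incl_ne h (j := -i) h1) (incl_ne h h2) ξ a)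
  | r5 i j k hij hjk hik a b =>
    exact
      mk_eq_of_rel L (Rel.r5 (i.incl h) (j.incl h) (k.incl h)
        ⟨incl_ne h hij.1, incl_ne h (j := -j) hij.2⟩ ⟨incl_ne h hjk.1, incl_ne h (j := -k) hjk.2⟩
        ⟨incl_ne h hik.1, incl_ne h (j := -k) hik.2⟩ a b)
  | r6 i j hij ξ ζ =>
    exact
      mk_eq_of_rel L (Rel.r6 (i.incl h) (j.incl h)
        ⟨incl_ne h (j := -j) hij.1, incl_ne h (j := - -j) hij.2⟩ ξ ζ)
  | r7 i ξ ζ =>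
    exact mk_eq_of_rel L (Rel.r7 (i.incl h) ξ ζ)
  | r8 i j hij hij' ξ b =>
    exact
      mk_eq_of_rel L (Rel.r8 (i.incl h) (j.incl h)
        ⟨incl_ne h hij.1, incl_ne h (j := -j) hij.2⟩
        ⟨incl_ne h (i := -i) hij'.1, incl_ne h (i := -i) (j := -j) hij'.2⟩ ξ b)
  | r9 i j hij hji a b =>
    exact
      mk_eq_of_rel L (Rel.r9 (i.incl h) (j.incl h)
        ⟨incl_ne h hij.1, incl_ne h (j := -j) hij.2⟩
        ⟨incl_ne h (j := -i) hji.1, incl_ne h (j := - -i) hji.2⟩ a b)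

/-- The natural homomorphism `StU(2m, R, 𝔏) → StU(2n, R, 𝔏)` for `m ≤ n`, sending `X_ij(a)` to
`X_ij(a)` and `X_i(ξ)` to `X_i(ξ)`. -/
def trans {m n : ℕ} (h : m ≤ n) : StU L m →* StU L n :=
  PresentedGroup.toGroup (f := genMap L h) (by
    rintro r ⟨x, y, hr, rfl⟩
    rw [map_mul, map_inv, genMap_rel L h hr, mul_inv_cancel])

@[simp] theorem trans_X {m n : ℕ} (h : m ≤ n) (i j : Idx m) (hij : i ≠ j ∧ i ≠ -j) (a : R) :
    trans L h (X L i j hij a) =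
      X L (i.incl h) (j.incl h) ⟨incl_ne h hij.1, incl_ne h (j := -j) hij.2⟩ a :=
  PresentedGroup.toGroup.of _

@[simp] theorem trans_Y {m n : ℕ} (h : m ≤ n) (i : Idx m) (ξ : L.toAddSubgroup) :
    trans L h (Y L i ξ) = Y L (i.incl h) ξ :=
  PresentedGroup.toGroup.of _

/-- The transition maps of the sequence `StU(2n, R, 𝔏)`, `n ≥ 3`. -/
def sys (m n : Set.Ici 3) (h : m ≤ n) : StU L m.1 →* StU L n.1 := trans L h

instance : DirectedSystem (fun n : Set.Ici 3 => StU L n.1) (fun _ _ h => sys L _ _ h) where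
  map_self n x := by
    have : trans L (le_refl n.1) = MonoidHom.id _ := by
      refine PresentedGroup.ext ?_
      rintro (⟨i, j, hij, a⟩ | ⟨i, ξ⟩)
      · exact trans_X L _ i j hij a
      · exact trans_Y L _ i ξ
    exact DFunLike.congr_fun this x
  map_map m n k hmn hnk x := by
    have : (trans L hnk).comp (trans L hmn) = trans L (hmn.trans hnk) := by
      refine PresentedGroup.ext ?_
      rintro (⟨i, j, hij, a⟩ | ⟨i, ξ⟩)
      · exact (congrArg (trans L hnk) (trans_X L hmn i j hij a)).trans
          ((trans_X L hnk _ _ _ a).trans (trans_X L (hmn.trans hnk) i j hij a).symm)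
      · exact (congrArg (trans L hnk) (trans_Y L hmn i ξ)).trans
          ((trans_Y L hnk _ ξ).trans (trans_Y L (hmn.trans hnk) i ξ).symm)
    exact DFunLike.congr_fun this x

end StU

/-- `StU(∞, R, 𝔏)`, the direct limit of the groups `StU(2n, R, 𝔏)`, `n ≥ 3`. -/
abbrev StUInf (L : OddFormParameter B) : Type (max u v) :=
  DirectLimit (fun n : Set.Ici 3 => StU L n.1) (StU.sys L)

noncomputable instance (L : OddFormParameter B) : Group (StUInf L) := inferInstance

/-- The element `X_ij(a)` of `StU(∞, R, 𝔏)`, where `n ≥ 3` is any number with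
`i, j ∈ {1, …, n, -n, …, -1}`: the class of `X_ij(a) ∈ StU(2n, R, 𝔏)`. -/
def StUInf.X (L : OddFormParameter B) (n : Set.Ici 3) (i j : Idx n.1) (hij : i ≠ j ∧ i ≠ -j)
    (a : R) : StUInf L :=
  ⟦⟨n, StU.X L i j hij a⟩⟧

end Form

/-- A central extension of `G`: an epimorphism onto `G` whose kernel is central. -/
structure IsCentralExtension {H : Type w} {G : Type v} [Group H] [Group G] (e : H →* G) : Prop where
  surjective : Function.Surjective e
  ker_le_center : e.ker ≤ Subgroup.center H

/-- The extension splits: it has a right inverse homomorphism. -/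
def Splits {H : Type w} {G : Type v} [Group H] [Group G] (e : H →* G) : Prop :=
  ∃ s : G →* H, e.comp s = MonoidHom.id G

/-- Any lifts of `x` and `y` commute, i.e. `[e⁻¹ x, e⁻¹ y] = 1`. -/
def LiftsCommute {H : Type w} {G : Type v} [Group H] [Group G] (e : H →* G) (x y : G) : Prop :=
  ∀ p q : H, e p = x → e q = y → ⁅p, q⁆ = 1

/-- `Card {±i, ±j, ±k, ±h} = 8`. -/
def EightDistinct {n : ℕ} (i j k h : Idx n) : Prop :=
  ({i, -i, j, -j, k, -k, h, -h} : Finset (Idx n)).card = 8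

end OddUnitary

/-! In a central extension the commutator of two elements of `H` depends only on their images, so
any Steinberg relation that produces a generator from a commutator suggests a canonical lift of that
generator. The proof chooses lifts in this way and checks that they satisfy the Steinberg relations
in `H` (`Setup.exists_lift`); the presentation then yields the section.

Two mechanisms do most of the work. If x commutes in G with y and z, then all lifts of x commute
with all lifts of [y, z] (`IsCentralExtension.cc_commutator`). Writing X_hk as [X_hl, X_lk] with a
spare index l lifts R3 and R4. A spare l may be missing only when the two long roots share no index
up to sign, and that case is the hypothesis of the theorem. Secondly, [x, [y, z]] = [[x, y], z]
under suitable commutations (`commutator_eq_of_commute`). This makes the lifted long elements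
independent of the intermediate index, and gives R5 and R6.

For short roots, R8 produces X_{-j} together with a long factor. Stripping that factor from a lifted
commutator gives `sh i j ξ b`, which a priori depends on i and on the pair (ξ, b).
`PreShortLift.twist` compares these elements up to lifts `T` of the trace elements X_i(0, c + c̄).
Together with `TraceLift.commutator_long`, which identifies `T` among the short lifts, it gives R8
and R9.

For n = ∞ the extension is pulled back to each finite level. The finite groups are perfect, so the
lifts obtained there are unique and glue. -/

namespace OddUnitary

universe u v w

/-! ### Commutator calculus in central extensions -/

section CentralExtension

variable {H : Type w} {G : Type v} [Group H] [Group G]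

/-- Conjugation by x fixes z and sends y to [x, y]y, so the left side is [[x, y]y, z]; expand this
in the first argument. -/
theorem conj_commutator_of_commute {x y z : H} (h : Commute x z) :
    x * ⁅y, z⁆ * x⁻¹ = ⁅x, y⁆ * ⁅y, z⁆ * ⁅x, y⁆⁻¹ * ⁅⁅x, y⁆, z⁆ := by
  have h1 : x⁻¹ * z * x = z := by rw [mul_assoc, ← h.eq, inv_mul_cancel_left]
  have h2 : x * z⁻¹ * x⁻¹ = z⁻¹ := by rw [h.inv_right.eq, mul_inv_cancel_right]
  calc x * ⁅y, z⁆ * x⁻¹ = x * y * z * y⁻¹ * x⁻¹ * (x * z⁻¹ * x⁻¹) := by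
        simp only [commutatorElement_def]; group
    _ = x * y * (x⁻¹ * z * x) * y⁻¹ * x⁻¹ * z⁻¹ := by rw [h2, h1]
    _ = _ := by simp only [commutatorElement_def]; group

theorem commutator_eq_of_commute {x y z : H} (h : Commute x z) (h1 : Commute ⁅x, y⁆ ⁅y, z⁆)
    (h2 : Commute ⁅⁅x, y⁆, z⁆ ⁅y, z⁆) : ⁅x, ⁅y, z⁆⁆ = ⁅⁅x, y⁆, z⁆ := by
  rw [commutatorElement_def x, conj_commutator_of_commute h, h1.eq, mul_inv_cancel_right, ← h2.eq,
    mul_inv_cancel_right]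

theorem commutator_mul_left (x y z : H) : ⁅x * y, z⁆ = x * ⁅y, z⁆ * x⁻¹ * ⁅x, z⁆ := by
  simp only [commutatorElement_def]; group

theorem commutator_mul_right (x y z : H) : ⁅x, y * z⁆ = ⁅x, y⁆ * (y * ⁅x, z⁆ * y⁻¹) := by
  simp only [commutatorElement_def]; group

theorem commute_conj {x y : H} (h : Commute x y) : x * y * x⁻¹ = y := by
  rw [h.eq, mul_inv_cancel_right]

/-- All lifts of `x` commute with all lifts of `y`. -/
def CC (e : H →* G) (x y : G) : Prop := ∀ p q : H, e p = x → e q = y → Commute p q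

variable {e : H →* G}

theorem CC.symm {x y : G} (h : CC e x y) : CC e y x := fun p q hp hq => (h q p hq hp).symm

/-- Two lifts of one element differ by a central factor, and central factors drop out of
commutators. -/
theorem IsCentralExtension.commutator_congr (he : IsCentralExtension e) {p p' q q' : H}
    (hp : e p = e p') (hq : e q = e q') : ⁅p, q⁆ = ⁅p', q'⁆ := by
  have key : ∀ a b : H, e a = e b → ∃ z, (∀ g, Commute z g) ∧ a = z * b := by
    intro a b hab
    refine ⟨a * b⁻¹, fun g => ?_, by group⟩
    have : a * b⁻¹ ∈ Subgroup.center H :=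
      he.ker_le_center (by rw [MonoidHom.mem_ker, map_mul, map_inv, hab, mul_inv_cancel])
    exact ((Subgroup.mem_center_iff.1 this) g).symm
  obtain ⟨z, hz, rfl⟩ := key p p' hp
  obtain ⟨t, ht, rfl⟩ := key q q' hq
  rw [commutator_mul_left, commutator_mul_right]
  have h1 : ⁅z, t * q'⁆ = 1 := commutatorElement_eq_one_iff_commute.2 (hz _)
  have h2 : ⁅p', t⁆ = 1 := commutatorElement_eq_one_iff_commute.2 (ht _).symm
  rw [h1, h2, one_mul, mul_one, commute_conj (hz _), commute_conj (ht _)]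

theorem IsCentralExtension.cc_of_commute (he : IsCentralExtension e) {p q : H} (h : Commute p q) :
    CC e (e p) (e q) := fun p' q' hp hq => by
  rw [← commutatorElement_eq_one_iff_commute, he.commutator_congr hp hq,
    commutatorElement_eq_one_iff_commute]
  exact h

/-- Conjugation by a lift of x changes lifts of y and z only by kernel elements, which their
commutator does not see. Thus commuting in G alone forces commuting of lifts. -/
theorem IsCentralExtension.cc_commutator (he : IsCentralExtension e) {x y z : G}
    (hy : Commute x y) (hz : Commute x z) : CC e x ⁅y, z⁆ := by
  obtain ⟨p, rfl⟩ := he.surjective x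
  obtain ⟨q, rfl⟩ := he.surjective y
  obtain ⟨r, rfl⟩ := he.surjective z
  rw [← map_commutatorElement]
  refine he.cc_of_commute ?_
  have h1 : e (p * q * p⁻¹) = e q := by simpa using commute_conj hy
  have h2 : e (p * r * p⁻¹) = e r := by simpa using commute_conj hz
  have := he.commutator_congr h1 h2
  rw [← conjugate_commutatorElement] at this
  exact mul_inv_eq_iff_eq_mul.1 this

theorem IsCentralExtension.cc_mul (he : IsCentralExtension e) {x y z : G}
    (hy : CC e x y) (hz : CC e x z) : CC e x (y * z) := by
  obtain ⟨p, rfl⟩ := he.surjective x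
  obtain ⟨q, rfl⟩ := he.surjective y
  obtain ⟨r, rfl⟩ := he.surjective z
  rw [← map_mul]
  exact he.cc_of_commute ((hy p q rfl rfl).mul_right (hz p r rfl rfl))

end CentralExtension

/-! ### Indices up to sign -/

section Index

variable {n : ℕ}

instance : InvolutiveNeg (Idx n) where
  neg_neg i := Subtype.ext (neg_neg i.1)

theorem Idx.neg_val (i : Idx n) : (-i).1 = -i.1 := rfl

theorem Idx.ext_iff {i j : Idx n} : i = j ↔ i.1 = j.1 := Subtype.ext_iff

theorem Idx.neg_ne (i : Idx n) : -i ≠ i := fun h => by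
  have := congrArg (fun t : Idx n => t.1) h
  have h0 := i.2.1
  simp only [Idx.neg_val] at this
  omega

theorem Idx.ne_neg (i : Idx n) : i ≠ -i := i.neg_ne.symm

/-- The indices `i` and `j` satisfy `i ≠ ±j`. -/
abbrev D (i j : Idx n) : Prop := i ≠ j ∧ i ≠ -j

theorem D_iff {i j : Idx n} : D i j ↔ i.1.natAbs ≠ j.1.natAbs := by
  rw [D, Ne, Ne, Idx.ext_iff, Idx.ext_iff, Idx.neg_val]
  omega

theorem D.symm {i j : Idx n} (h : D i j) : D j i := D_iff.2 (D_iff.1 h).symm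

theorem D.negl {i j : Idx n} (h : D i j) : D (-i) j := by
  rw [D_iff, Idx.neg_val, Int.natAbs_neg]; exact D_iff.1 h

theorem D.negr {i j : Idx n} (h : D i j) : D i (-j) := h.symm.negl.symm

theorem D.neg {i j : Idx n} (h : D i j) : D (-i) (-j) := h.negl.negr

theorem not_D {i j : Idx n} (h : ¬ D i j) : i = j ∨ i = -j := by
  by_contra h'
  exact h (not_or.1 h')

/-- Three indices exclude at most three of the absolute values 1, 2, 3, 4. The bound n ≥ 4 is needed
for this spare index. -/
theorem exists_D (hn : 4 ≤ n) (i j k : Idx n) : ∃ l : Idx n, D l i ∧ D l j ∧ D l k := by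
  have key : ∃ m : ℕ, 1 ≤ m ∧ m ≤ 4 ∧ m ≠ i.1.natAbs ∧ m ≠ j.1.natAbs ∧ m ≠ k.1.natAbs := by
    by_contra h
    push Not at h
    have h1 := h 1
    have h2 := h 2
    have h3 := h 3
    have h4 := h 4
    omega
  obtain ⟨m, h1, h4, hi, hj, hk⟩ := key
  refine ⟨⟨m, by omega, by simp; omega⟩, ?_, ?_, ?_⟩ <;> refine D_iff.2 ?_ <;> simpa

theorem exists_D_of_three_le (hn : 3 ≤ n) (i j : Idx n) : ∃ l : Idx n, D l i ∧ D l j := by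
  have key : ∃ m : ℕ, 1 ≤ m ∧ m ≤ 3 ∧ m ≠ i.1.natAbs ∧ m ≠ j.1.natAbs := by
    by_contra h
    push Not at h
    have h1 := h 1
    have h2 := h 2
    have h3 := h 3
    omega
  obtain ⟨m, h1, h4, hi, hj⟩ := key
  refine ⟨⟨m, by omega, by simp; omega⟩, ?_, ?_⟩ <;> refine D_iff.2 ?_ <;> simpa

/-- An overlap between the two pairs leaves at most three absolute values to avoid. -/
theorem exists_D_four (hn : 4 ≤ n) (i j h k : Idx n)
    (hd : ¬ (D h i ∧ D h j ∧ D k i ∧ D k j)) : ∃ l : Idx n, D l i ∧ D l j ∧ D l h ∧ D l k := by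
  have h1 : ¬ D h i ∨ ¬ D h j ∨ ¬ D k i ∨ ¬ D k j := by tauto
  simp only [D_iff, ne_eq, not_not] at h1 ⊢
  rcases h1 with h1 | h1 | h1 | h1
  · obtain ⟨l, a, b, c⟩ := exists_D hn i j k
    rw [D_iff] at a b c
    exact ⟨l, a, b, h1 ▸ a, c⟩
  · obtain ⟨l, a, b, c⟩ := exists_D hn i j k
    rw [D_iff] at a b c
    exact ⟨l, a, b, h1 ▸ b, c⟩
  · obtain ⟨l, a, b, c⟩ := exists_D hn i j h
    rw [D_iff] at a b c
    exact ⟨l, a, b, c, h1 ▸ a⟩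
  · obtain ⟨l, a, b, c⟩ := exists_D hn i j h
    rw [D_iff] at a b c
    exact ⟨l, a, b, c, h1 ▸ b⟩

theorem eightDistinct {i j k h : Idx n} (hij : D i j) (hkh : D k h) (h1 : D k i) (h2 : D k j)
    (h3 : D h i) (h4 : D h j) : EightDistinct i j k h := by
  simp only [D_iff] at *
  have := i.2.1
  have := j.2.1
  have := k.2.1
  have := h.2.1
  unfold EightDistinct
  repeat rw [Finset.card_insert_of_notMem (by
    simp only [Finset.mem_insert, Finset.mem_singleton, Idx.ext_iff, Idx.neg_val]; omega)]
  simp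

end Index

/-! ### Sign identities, operations on the form parameter, Steinberg relations -/

section Relations

variable {R : Type u} [Ring R] {J : PseudoInvolution R} {V : Type v} [AddCommGroup V]
  [Module Rᵐᵒᵖ V] {B : AntiHermitianForm J V}

namespace PseudoInvolution

theorem bar_oneBar_inv (J : PseudoInvolution R) :
    J.bar (↑J.oneBar⁻¹ : R) = J.oneBar * J.oneBar := by
  have h := J.bar_mul J.oneBar (↑J.oneBar⁻¹ : R)
  rw [Units.mul_inv, J.bar_one, J.bar_oneBar, mul_one] at h
  exact ((Units.eq_mul_inv_iff_mul_eq _).1 h).symm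

end PseudoInvolution

variable {n : ℕ}

theorem sgn_cases (J : PseudoInvolution R) (i : Idx n) :
    (sgn J i = (↑J.oneBar⁻¹ : R) ∧ sgn J (-i) = -1) ∨
      (sgn J i = -1 ∧ sgn J (-i) = (↑J.oneBar⁻¹ : R)) := by
  have h0 := i.2.1
  have hn := Idx.neg_val i
  rcases lt_or_gt_of_ne h0 with h | h
  · right
    constructor
    · rw [sgn, if_neg (by omega)]
    · rw [sgn, if_pos (by omega)]
  · left
    constructor
    · rw [sgn, if_pos (by omega)]
    · rw [sgn, if_neg (by omega)]

theorem sgn_mul_sgn_neg (J : PseudoInvolution R) (i : Idx n) :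
    sgn J i * sgn J (-i) = -(↑J.oneBar⁻¹ : R) := by
  rcases sgn_cases J i with ⟨h1, h2⟩ | ⟨h1, h2⟩ <;> rw [h1, h2] <;> simp

theorem oneBar_mul_sgn (J : PseudoInvolution R) (i : Idx n) :
    J.oneBar * sgn J i = sgn J i * J.oneBar := by
  rcases sgn_cases J i with ⟨h1, h2⟩ | ⟨h1, h2⟩ <;> rw [h1] <;> simp

theorem sgn_neg_mul_oneBar_mul_sgn (J : PseudoInvolution R) (i : Idx n) :
    sgn J (-i) * (J.oneBar * sgn J i) = -1 := by
  rcases sgn_cases J i with ⟨h1, h2⟩ | ⟨h1, h2⟩ <;> rw [h1, h2] <;> simp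

theorem sgn_mul_oneBar_mul_sgn_neg (J : PseudoInvolution R) (i : Idx n) :
    sgn J i * (J.oneBar * sgn J (-i)) = -1 := by
  rcases sgn_cases J i with ⟨h1, h2⟩ | ⟨h1, h2⟩ <;> rw [h1, h2] <;> simp

theorem oneBar_inv_mul_bar_sgn (J : PseudoInvolution R) (i : Idx n) :
    (↑J.oneBar⁻¹ : R) * J.bar (sgn J i) * sgn J i = 1 := by
  rcases sgn_cases J i with ⟨h1, h2⟩ | ⟨h1, h2⟩ <;> rw [h1] <;> simp [J.bar_one, J.bar_oneBar_inv]

namespace OddFormParameter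

variable (L : OddFormParameter B)

/-- `(x, a) ↦ (x, -ā)` on `𝔏`. -/
def conj (ξ : L.toAddSubgroup) : L.toAddSubgroup :=
  ⟨⟨ξ.1.vec, -J.bar ξ.1.scal⟩, L.conj_mem ξ⟩

/-- The right action of `R` on `𝔏`. -/
def actL (ξ : L.toAddSubgroup) (b : R) : L.toAddSubgroup :=
  ⟨ξ.1.act b, L.act_mem _ ξ.2 b⟩

/-- The element `(0, c + c̄)` of `𝔏`. -/
def tr (c : R) : L.toAddSubgroup := ⟨⟨0, c + J.bar c⟩, L.trace_mem c⟩

@[simp] theorem conj_vec (ξ : L.toAddSubgroup) : (L.conj ξ).1.vec = ξ.1.vec := rfl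
@[simp] theorem conj_scal (ξ : L.toAddSubgroup) : (L.conj ξ).1.scal = -J.bar ξ.1.scal := rfl
@[simp] theorem actL_vec (ξ : L.toAddSubgroup) (b : R) :
    (L.actL ξ b).1.vec = ξ.1.vec <• b := rfl
@[simp] theorem actL_scal (ξ : L.toAddSubgroup) (b : R) :
    (L.actL ξ b).1.scal = J.bar b * (↑J.oneBar⁻¹ : R) * ξ.1.scal * b := rfl
@[simp] theorem tr_vec (c : R) : (L.tr c).1.vec = 0 := rfl
@[simp] theorem tr_scal (c : R) : (L.tr c).1.scal = c + J.bar c := rfl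

variable {L}

theorem ext_param {ξ ζ : L.toAddSubgroup} (h1 : ξ.1.vec = ζ.1.vec) (h2 : ξ.1.scal = ζ.1.scal) :
    ξ = ζ := Subtype.ext (Heisenberg.ext h1 h2)

theorem conj_conj (ξ : L.toAddSubgroup) : L.conj (L.conj ξ) = ξ :=
  ext_param rfl (by simp [J.bar_bar])

theorem actL_one (ξ : L.toAddSubgroup) : L.actL ξ 1 = ξ :=
  ext_param (by simp) (by simp [J.bar_one])

theorem conj_actL (ξ : L.toAddSubgroup) (b : R) : L.conj (L.actL ξ b) = L.actL (L.conj ξ) b :=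
  ext_param rfl (by simp [J.bar_mul, J.bar_oneBar_inv, J.bar_bar, mul_assoc])

/-- On 𝔏, `conj` is the group inverse followed by the action of -1, which is an automorphism; hence
the order reverses. -/
theorem conj_add (ξ ζ : L.toAddSubgroup) : L.conj (ξ + ζ) = L.conj ζ + L.conj ξ :=
  ext_param (by simp [add_comm]) (by
    have := B.anti ζ.1.vec ξ.1.vec
    simp [this]; abel)

end OddFormParameter

variable {G : Type w} [Group G] (L : OddFormParameter B)

/-- The elements `X i j a` and `Y i ξ` of a group satisfy the Steinberg relations. -/
structure SteinbergRel (X : Idx n → Idx n → R → G) (Y : Idx n → L.toAddSubgroup → G) :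
    Prop where
  r0 : ∀ {i j} (a), D i j → X i j a = X (-j) (-i) (sgn J (-j) * J.bar a * sgn J i)
  r1 : ∀ {i j} (a b), D i j → X i j a * X i j b = X i j (a + b)
  r2 : ∀ i ξ ζ, Y i ξ * Y i ζ = Y i (ξ + ζ)
  r3 : ∀ {i j h k} (a b), D i j → D h k → h ≠ j → h ≠ -i → k ≠ i → k ≠ -j →
    Commute (X i j a) (X h k b)
  r4 : ∀ {i j k} (ξ a), D j k → j ≠ -i → k ≠ i → Commute (Y i ξ) (X j k a)
  r5 : ∀ {i j k} (a b), D i j → D j k → D i k → ⁅X i j a, X j k b⁆ = X i k (a * b)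
  r6 : ∀ {i j} (ξ ζ : L.toAddSubgroup), D i j →
    ⁅Y i ξ, Y j ζ⁆ = X i (-j) (sgn J i * B ξ.1.vec ζ.1.vec)
  r8 : ∀ {i j} (ξ : L.toAddSubgroup) (b), D i j →
    ⁅Y i ξ, X (-i) j b⁆ = X i j (sgn J i * ξ.1.scal * b) * Y (-j) (L.actL (L.conj ξ) b)
  r9 : ∀ {i j} (a b), D i j →
    ⁅X i j a, X j (-i) b⁆ = Y i (L.tr (-(sgn J (-i) * J.oneBar * a * b)))

end Relations

/-! ### Lifting the long root elements -/

section LongRoots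

variable {R : Type u} [Ring R] {J : PseudoInvolution R} {V : Type v} [AddCommGroup V]
  [Module Rᵐᵒᵖ V] {B : AntiHermitianForm J V} {n : ℕ} {L : OddFormParameter B}
  {H G : Type*} [Group H] [Group G]

variable (L) in
/-- A central extension of a group with Steinberg generators in which the lifts of long root
elements without common indices commute. -/
structure Setup (e : H →* G) (X : Idx n → Idx n → R → G) (Y : Idx n → L.toAddSubgroup → G) :
    Prop where
  rel : SteinbergRel L X Y
  central : IsCentralExtension e
  four : 4 ≤ n
  eight : ∀ {i j k h} (a b), D i j → D k h → D k i → D k j → D h i → D h j →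
    CC e (X i j a) (X k h b)

variable {e : H →* G} {X : Idx n → Idx n → R → G} {Y : Idx n → L.toAddSubgroup → G}

/-- Unless the indices are distinct up to sign, there is a spare l with X_hk(b) = [X_hl(b),
X_lk(1)], and both factors commute with X_ij(a) by R3. -/
theorem Setup.cc_long (S : Setup L e X Y) {i j h k : Idx n} (a b : R) (hij : D i j) (hhk : D h k)
    (h1 : h ≠ j) (h2 : h ≠ -i) (h3 : k ≠ i) (h4 : k ≠ -j) : CC e (X i j a) (X h k b) := by
  by_cases hd : D h i ∧ D h j ∧ D k i ∧ D k j
  · obtain ⟨d1, d2, d3, d4⟩ := hd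
    exact S.eight a b hij hhk d1 d2 d3 d4
  · obtain ⟨l, d1, d2, d3, d4⟩ := exists_D_four S.four i j h k hd
    have := S.rel.r5 b 1 d3.symm d4 hhk
    rw [mul_one] at this
    rw [← this]
    exact S.central.cc_commutator (S.rel.r3 a b hij d3.symm h1 h2 d1.1 d2.2)
      (S.rel.r3 a 1 hij d4 d2.1 d1.2 h3 h4)

/-- Three indices always leave a spare l, so R4 for the factors of X_jk(a) = [X_jl(a), X_lk(1)]
suffices, without the hypothesis on disjoint long roots. -/
theorem Setup.cc_short (S : Setup L e X Y) {i j k : Idx n} (ξ : L.toAddSubgroup) (a : R)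
    (hjk : D j k) (h1 : j ≠ -i) (h2 : k ≠ i) : CC e (Y i ξ) (X j k a) := by
  obtain ⟨l, d1, d2, d3⟩ := exists_D S.four i j k
  have := S.rel.r5 a 1 d2.symm d3 hjk
  rw [mul_one] at this
  rw [← this]
  exact S.central.cc_commutator (S.rel.r4 ξ a d2.symm h1 d1.1) (S.rel.r4 ξ 1 d3 d1.2 h2)

/-- Lifts `x i j a` of the elements `X i j a` that satisfy the long root relations. -/
structure LongLift (e : H →* G) (X : Idx n → Idx n → R → G) (x : Idx n → Idx n → R → H) :
    Prop where
  map : ∀ {i j} (a), D i j → e (x i j a) = X i j a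
  comm : ∀ {i j k} (a b), D i j → D j k → D i k → ∀ {p q}, e p = X i j a → e q = X j k b →
    ⁅p, q⁆ = x i k (a * b)
  add : ∀ {i j} (a b), D i j → x i j a * x i j b = x i j (a + b)
  flip : ∀ {i j} (a), D i j → x i j a = x (-j) (-i) (sgn J (-j) * J.bar a * sgn J i)

/-- The lift of X_ij(a) is the commutator of lifts of X_ik(a) and X_kj(1). Regrouping commutators
moves scalars from one factor to the other and changes k, so the commutator for (a, b) depends only
on ab. -/
theorem Setup.exists_longLift (S : Setup L e X Y) : ∃ x, LongLift (J := J) e X x := by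
  have hs := S.central.surjective
  set s : G → H := Function.surjInv hs
  have es : ∀ g, e (s g) = g := Function.surjInv_eq hs
  set f : Idx n → Idx n → Idx n → R → R → H := fun i k j a b => ⁅s (X i k a), s (X k j b)⁆ with hf
  have f_eq : ∀ {i k j a b p q}, e p = X i k a → e q = X k j b → f i k j a b = ⁅p, q⁆ :=
    fun hp hq => S.central.commutator_congr ((es _).trans hp.symm) ((es _).trans hq.symm)
  have map_f : ∀ {i k j} (a b), D i k → D k j → D i j → e (f i k j a b) = X i j (a * b) := by
    intro i k j a b h1 h2 h3
    rw [hf, map_commutatorElement, es, es, S.rel.r5 a b h1 h2 h3]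
  have f_assoc : ∀ {i k l j} (a b d), D i k → D i l → D i j → D k l → D k j → D l j →
      f i k j a (b * d) = f i l j (a * b) d := by
    intro i k l j a b d hik hil hij hkl hkj hlj
    have e1 : e ⁅s (X k l b), s (X l j d)⁆ = X k j (b * d) := by
      rw [map_commutatorElement, es, es, S.rel.r5 b d hkl hlj hkj]
    have e2 : e ⁅s (X i k a), s (X k l b)⁆ = X i l (a * b) := by
      rw [map_commutatorElement, es, es, S.rel.r5 a b hik hkl hil]
    rw [f_eq (es _) e1, f_eq e2 (es _)]
    refine commutator_eq_of_commute ?_ ?_ ?_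
    · exact S.cc_long a d hik hlj hkl.symm.1 hil.symm.2 hij.symm.1 hkj.symm.2 _ _ (es _) (es _)
    · exact S.cc_long _ _ hil hkj hkl.1 hik.symm.2 hij.symm.1 hlj.symm.2 _ _ e2 e1
    · refine S.cc_long (a * b * d) (b * d) hij hkj hkj.1 hik.symm.2 hij.symm.1 j.ne_neg _ _ ?_ e1
      rw [map_commutatorElement, e2, es, S.rel.r5 (a * b) d hil hlj hij]
  have f_one : ∀ {i k l j} (a b), D i k → D i l → D i j → D k l → D k j → D l j →
      f i k j a b = f i l j (a * b) 1 := by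
    intro i k l j a b hik hil hij hkl hkj hlj
    rw [← f_assoc a b 1 hik hil hij hkl hkj hlj, mul_one]
  have f_indep : ∀ {i k l j} (a b), D i k → D i l → D i j → D k j → D l j →
      f i k j a b = f i l j (a * b) 1 := by
    intro i k l j a b hik hil hij hkj hlj
    by_cases hkl : D k l
    · exact f_one a b hik hil hij hkl hkj hlj
    -- Regrouping needs k ≠ ±l; when k = ±l, pass through a third intermediate index m.
    · obtain ⟨m, m1, m2, m3⟩ := exists_D S.four i j k
      have m4 : D m l := by
        rcases not_D hkl with rfl | rfl
        · exact m3
        · simpa using m3.negr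
      rw [f_one a b hik m1.symm hij m3.symm hkj m2, f_one (a * b) 1 m1.symm hil hij m4 m2 hlj,
        mul_one]
  choose c c1 c2 using fun i j : Idx n => exists_D_of_three_le (le_trans (by norm_num) S.four) i j
  have f_add : ∀ {i k j} (a a' b), D i k → D k j → D i j →
      f i k j a b * f i k j a' b = f i k j (a + a') b := by
    intro i k j a a' b h1 h2 h3
    have e1 : e (s (X i k a) * s (X i k a')) = X i k (a + a') := by
      rw [map_mul, es, es, S.rel.r1 a a' h1]
    rw [f_eq e1 (es _), commutator_mul_left, commute_conj]
    · exact S.cc_long _ _ h3 h3 h3.1 i.ne_neg h3.symm.1 j.ne_neg _ _ (map_f _ _ h1 h2 h3)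
        (map_f _ _ h1 h2 h3)
    · exact S.cc_long _ _ h1 h3 h1.1 i.ne_neg h3.symm.1 h2.symm.2 _ _ (es _)
        (map_f _ _ h1 h2 h3)
  have hx : ∀ {i k j} (a b), D i k → D k j → D i j → f i k j a b = f i (c i j) j (a * b) 1 :=
    fun {i k j} a b h1 h2 h3 => f_indep a b h1 (c1 i j).symm h3 h2 (c2 i j)
  refine ⟨fun i j a => f i (c i j) j a 1, ⟨?_, ?_, ?_, ?_⟩⟩
  · intro i j a h
    rw [map_f a 1 (c1 i j).symm (c2 i j) h, mul_one]
  · intro i j k a b h1 h2 h3 p q hp hq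
    rw [← f_eq hp hq, hx a b h1 h2 h3]
  · intro i j a b h
    exact f_add a b 1 (c1 i j).symm (c2 i j) h
  · intro i j a h
    set k := c i j
    have h1 : D i k := (c1 i j).symm
    have h2 : D k j := c2 i j
    set p := sgn J (-j) * J.bar 1 * sgn J k
    set q := sgn J (-k) * J.bar a * sgn J i
    -- R0 rewrites both factors and exchanges their roles, so the commutator becomes the inverse of
    -- the one for (-j, -k, -i). The minus sign from ε_k ε_{-k} = -1̄⁻¹ compensates for this
    -- inverse.
    have e1 : e (s (X i k a)) = X (-k) (-i) q := (es _).trans (S.rel.r0 a h1)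
    have e2 : e (s (X k j 1)) = X (-j) (-k) p := (es _).trans (S.rel.r0 1 h2)
    have hpq : p * -q = sgn J (-j) * J.bar a * sgn J i := by
      simp only [p, q, J.bar_one]
      have := sgn_mul_sgn_neg J k
      calc _ = -(sgn J (-j) * J.oneBar * (sgn J k * sgn J (-k)) * J.bar a * sgn J i) := by
            noncomm_ring
        _ = _ := by rw [this]; simp [mul_assoc]
    have hneg : f (-j) (-k) (-i) p q * f (-j) (-k) (-i) p (-q) = 1 := by
      have d1 := h2.neg.symm
      have d2 := h1.neg.symm
      have d3 := h.neg.symm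
      rw [hx _ _ d1 d2 d3, hx _ _ d1 d2 d3, f_add _ _ _ (c1 _ _).symm (c2 _ _) d3, mul_neg,
        add_neg_cancel]
      have := f_add (0 : R) 0 1 (c1 (-j) (-i)).symm (c2 _ _) d3
      rw [add_zero] at this
      exact mul_eq_left.1 this
    change ⁅s (X i k a), s (X k j 1)⁆ = f (-j) (c (-j) (-i)) (-i) _ 1
    rw [← hpq, ← hx _ _ h2.neg.symm h1.neg.symm h.neg.symm, ← commutatorElement_inv,
      ← f_eq e2 e1, eq_comm, ← mul_eq_one_iff_eq_inv', hneg]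

end LongRoots

/-! ### Commutators of short root lifts, and lifts of trace elements -/

section ShortRoots

variable {R : Type u} [Ring R] {J : PseudoInvolution R} {V : Type v} [AddCommGroup V]
  [Module Rᵐᵒᵖ V] {B : AntiHermitianForm J V} {n : ℕ} {L : OddFormParameter B}
  {H G : Type*} [Group H] [Group G]

variable {e : H →* G} {X : Idx n → Idx n → R → G} {Y : Idx n → L.toAddSubgroup → G}
  {x : Idx n → Idx n → R → H}

namespace LongLift

theorem zero (hx : LongLift (J := J) e X x) {i j : Idx n} (h : D i j) : x i j 0 = 1 := by
  have := hx.add 0 0 h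
  rw [add_zero] at this
  exact mul_eq_left.1 this

theorem inv (hx : LongLift (J := J) e X x) {i j : Idx n} (h : D i j) (a : R) :
    (x i j a)⁻¹ = x i j (-a) := by
  rw [inv_eq_iff_mul_eq_one, hx.add _ _ h, add_neg_cancel, hx.zero h]

theorem commute_long (S : Setup L e X Y) (hx : LongLift (J := J) e X x) {i j h k : Idx n} (a b : R)
    (hij : D i j) (hhk : D h k) (h1 : h ≠ j) (h2 : h ≠ -i) (h3 : k ≠ i) (h4 : k ≠ -j) :
    Commute (x i j a) (x h k b) :=
  S.cc_long a b hij hhk h1 h2 h3 h4 _ _ (hx.map a hij) (hx.map b hhk)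

theorem commute_short (S : Setup L e X Y) (hx : LongLift (J := J) e X x) {i j k : Idx n}
    {ξ : L.toAddSubgroup} {p : H} (hp : e p = Y i ξ) (a : R)
    (hjk : D j k) (h1 : j ≠ -i) (h2 : k ≠ i) : Commute p (x j k a) :=
  S.cc_short ξ a hjk h1 h2 _ _ hp (hx.map a hjk)

/-- By R8, Y_j(ζ) is a commutator of Y_k(conj ζ) and X_{-k,-j}(1), up to a long factor commuting
with p. Regrouping turns the bracket into [[p, m], w], where [p, m] lies over a long element, so the
long lift applies. -/
theorem commutator_short (S : Setup L e X Y) (hx : LongLift (J := J) e X x) {i j : Idx n}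
    {ξ ζ : L.toAddSubgroup} (hij : D i j) {p q : H} (hp : e p = Y i ξ) (hq : e q = Y j ζ) :
    ⁅p, q⁆ = x i (-j) (sgn J i * B ξ.1.vec ζ.1.vec) := by
  obtain ⟨k, dki, dkj⟩ := exists_D_of_three_le (le_trans (by norm_num) S.four) i j
  obtain ⟨m, hm⟩ := S.central.surjective (Y k (L.conj ζ))
  set w := x (-k) (-j) 1 with hw
  set β := sgn J k * (L.conj ζ).1.scal * 1
  have hmw : e ⁅m, w⁆ = X k (-j) β * Y j ζ := by
    rw [map_commutatorElement, hm, hx.map 1 dkj.neg, S.rel.r8 _ _ dkj.negr,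
      OddFormParameter.conj_conj, OddFormParameter.actL_one, neg_neg]
  have hq0 : e ((x k (-j) β)⁻¹ * ⁅m, w⁆) = Y j ζ := by
    rw [map_mul, map_inv, hx.map β dkj.negr, hmw, inv_mul_cancel_left]
  have hpm : e ⁅p, m⁆ = X i (-k) (sgn J i * B ξ.1.vec ζ.1.vec) := by
    rw [map_commutatorElement, hp, hm, S.rel.r6 _ _ dki.symm, OddFormParameter.conj_vec]
  have hpmw : ⁅⁅p, m⁆, w⁆ = x i (-j) (sgn J i * B ξ.1.vec ζ.1.vec) := by
    rw [hx.comm _ 1 dki.symm.negr dkj.neg hij.negr hpm (hx.map 1 dkj.neg), mul_one]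
  have c1 : Commute p (x k (-j) β) := hx.commute_short S hp β dkj.negr dki.2 hij.symm.negl.1
  have c2 : Commute p w := hx.commute_short S hp 1 dkj.neg dki.neg.1 hij.symm.negl.1
  have c3 : CC e (X i (-k) (sgn J i * B ξ.1.vec ζ.1.vec)) (X k (-j) β * Y j ζ) :=
    S.central.cc_mul
      (S.cc_long _ _ dki.symm.negr dkj.negr k.ne_neg dki.2 hij.symm.negl.1
        (by simpa using dkj.symm.negl.1))
      (S.cc_short _ _ dki.symm.negr hij.2 dkj.negl.1).symm
  have c4 : CC e (X i (-j) (sgn J i * B ξ.1.vec ζ.1.vec)) (X k (-j) β) :=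
    S.cc_long _ _ hij.negr dkj.negr dkj.2 dki.2 hij.symm.negl.1 (-j).ne_neg
  have c5 : CC e (X i (-j) (sgn J i * B ξ.1.vec ζ.1.vec)) (Y j ζ) :=
    (S.cc_short _ _ hij.negr hij.2 j.neg_ne).symm
  rw [S.central.commutator_congr rfl (hq.trans hq0.symm), commutator_mul_right,
    commutator_eq_of_commute c2 (c3 _ _ hpm hmw)
      (S.central.cc_mul c4 c5 _ _ (by rw [hpmw, hx.map _ hij.negr]) hmw), hpmw,
    commutatorElement_eq_one_iff_commute.2 c1.inv_right, one_mul]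
  exact commute_conj (c4 _ _ (hx.map _ hij.negr) (hx.map _ dkj.negr)).symm.inv_left

end LongLift

/-- Lifts `T i c` of the elements `X_i(0, c + c̄)`. -/
structure TraceLift (L : OddFormParameter B) (e : H →* G) (X : Idx n → Idx n → R → G)
    (Y : Idx n → L.toAddSubgroup → G) (T : Idx n → R → H) : Prop where
  map : ∀ i c, e (T i c) = Y i (L.tr c)
  comm : ∀ {i j} (a b), D i j → ∀ {p q}, e p = X i j a → e q = X j (-i) b →
    ⁅p, q⁆ = T i (-(sgn J (-i) * J.oneBar * a * b))
  add : ∀ i c d, T i c * T i d = T i (c + d)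

theorem TraceLift.inv {T : Idx n → R → H} (hT : TraceLift L e X Y T) (i : Idx n) (c : R) :
    (T i c)⁻¹ = T i (-c) := by
  have h0 : T i 0 = 1 := by
    have := hT.add i 0 0
    rw [add_zero] at this
    exact mul_eq_left.1 this
  rw [inv_eq_iff_mul_eq_one, hT.add, add_neg_cancel, h0]

/-- By R9 trace elements are commutators of long ones. Regrouping again shows that the commutator
for (a, b) depends only on i and ab. The lift is indexed by c itself; that it depends only on c + c̄
emerges later. -/
theorem Setup.exists_traceLift (S : Setup L e X Y) (hx : LongLift (J := J) e X x) :
    ∃ T, TraceLift L e X Y T := by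
  have h3 : 3 ≤ n := le_trans (by norm_num) S.four
  set t : Idx n → Idx n → R → R → H := fun i j a b => ⁅x i j a, x j (-i) b⁆ with ht
  have map_t : ∀ {i j} (a b), D i j →
      e (t i j a b) = Y i (L.tr (-(sgn J (-i) * J.oneBar * a * b))) := by
    intro i j a b h
    rw [ht, map_commutatorElement, hx.map a h, hx.map b h.symm.negr, S.rel.r9 a b h]
  have t_assoc : ∀ {i j k} (a b d), D i j → D i k → D j k → t i j a (b * d) = t i k (a * b) d := by
    intro i j k a b d hij hik hjk
    have e1 : ⁅x j k b, x k (-i) d⁆ = x j (-i) (b * d) :=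
      hx.comm b d hjk hik.symm.negr hij.symm.negr (hx.map b hjk) (hx.map d hik.symm.negr)
    have e2 : ⁅x i j a, x j k b⁆ = x i k (a * b) :=
      hx.comm a b hij hjk hik (hx.map a hij) (hx.map b hjk)
    have c1 : Commute (x i j a) (x k (-i) d) :=
      hx.commute_long S a d hij hik.symm.negr hjk.symm.1 hik.symm.2 i.neg_ne hij.neg.1
    have h := commutator_eq_of_commute (y := x j k b) c1
    rw [e1, e2] at h
    exact h (hx.commute_long S _ _ hik hij.symm.negr hjk.1 hij.symm.2 i.neg_ne hik.neg.1)
      (hx.commute_short S (map_t _ _ hik) _ hij.symm.negr hij.symm.2 i.neg_ne)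
  have t_one : ∀ {i j k} (a b), D i j → D i k → t i j a b = t i k (a * b) 1 := by
    intro i j k a b hij hik
    obtain ⟨l, l1, l2, l3⟩ := exists_D S.four i j k
    have h1 := t_assoc a b 1 hij l1.symm l2.symm
    have h2 := t_assoc (a * b) 1 1 l1.symm hik l3
    rw [mul_one] at h1
    simp only [mul_one] at h2
    rw [h1, h2]
  choose c hc _ using fun i : Idx n => exists_D_of_three_le h3 i i
  -- The argument ε_i r is chosen because -ε_{-i} 1̄ ε_i = 1, so that R9 lands on the trace element
  -- of r.
  have hε : ∀ (i : Idx n) (r : R), -(sgn J (-i) * J.oneBar * (sgn J i * r) * 1) = r := by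
    intro i r
    have h := sgn_neg_mul_oneBar_mul_sgn J i
    calc _ = -((sgn J (-i) * (J.oneBar * sgn J i)) * r) := by noncomm_ring
      _ = r := by rw [h]; simp
  refine ⟨fun i r => t i (c i) (sgn J i * r) 1, ⟨?_, ?_, ?_⟩⟩
  · intro i r
    rw [map_t _ _ (hc i).symm, hε]
  · intro i j a b hij p q hp hq
    rw [S.central.commutator_congr (hp.trans (hx.map a hij).symm)
      (hq.trans (hx.map b hij.symm.negr).symm)]
    change t i j a b = _
    rw [t_one a b hij (hc i).symm]
    congr 1
    have h := sgn_mul_oneBar_mul_sgn_neg J i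
    have h' := oneBar_mul_sgn J (-i)
    calc a * b = -((sgn J i * (J.oneBar * sgn J (-i))) * (a * b)) := by rw [h]; simp
      _ = _ := by rw [h']; noncomm_ring
  · intro i r s
    have d := (hc i).symm
    have hadd := hx.add (sgn J i * r) (sgn J i * s) d
    rw [← mul_add] at hadd
    change t i (c i) _ 1 * t i (c i) _ 1 = ⁅x i (c i) (sgn J i * (r + s)), x (c i) (-i) 1⁆
    rw [← hadd, commutator_mul_left]
    have hs := map_t (sgn J i * s) 1 d
    have hr := map_t (sgn J i * r) 1 d
    have c1 := hx.commute_short S hs (sgn J i * r) d i.ne_neg d.symm.1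
    -- The lift for r commutes with both long factors whose commutator is the lift for s.
    have c2 : Commute (t i (c i) (sgn J i * r) 1) (t i (c i) (sgn J i * s) 1) := by
      have := hx.commute_short S hr (sgn J i * s) d i.ne_neg d.symm.1
      have h' := hx.commute_short S hr 1 d.symm.negr d.symm.2 i.neg_ne
      have h1 : ∀ g y z : H, Commute g y → Commute g z → Commute g ⁅y, z⁆ := fun g y z hy hz =>
        ((hy.mul_right hz).mul_right hy.inv_right).mul_right hz.inv_right
      exact h1 _ _ _ this h'
    rw [show x i (c i) (sgn J i * r) * ⁅x i (c i) (sgn J i * s), x (c i) (-i) 1⁆ *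
      (x i (c i) (sgn J i * r))⁻¹ = _ from commute_conj c1.symm]
    exact c2.eq

end ShortRoots

/-! ### Lifting the short root elements -/

section ShortLifts

variable {R : Type u} [Ring R] {J : PseudoInvolution R} {V : Type v} [AddCommGroup V]
  [Module Rᵐᵒᵖ V] {B : AntiHermitianForm J V} {n : ℕ} {L : OddFormParameter B}
  {H G : Type*} [Group H] [Group G]

variable {e : H →* G} {X : Idx n → Idx n → R → G} {Y : Idx n → L.toAddSubgroup → G}
  {x : Idx n → Idx n → R → H} {T : Idx n → R → H}

/-- A form of the Hall–Witt identity that expresses `⁅⁅p, q⁆, w⁆` by commutators of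
`⁅p, w⁆` and `⁅q, w⁆`. -/
theorem commutator_commutator_left {p q w : H}
    (hZE : Commute ⁅q, ⁅p, w⁆⁆ ⁅p, w⁆) (hZA : Commute ⁅q, ⁅p, w⁆⁆ ⁅q, w⁆)
    (hZU : Commute ⁅q, ⁅p, w⁆⁆ ⁅p, ⁅q, w⁆⁆)
    (hUA : Commute ⁅p, ⁅q, w⁆⁆ ⁅q, w⁆) (hUE : Commute ⁅p, ⁅q, w⁆⁆ ⁅p, w⁆)
    (hgZ : Commute ⁅p, q⁆ ⁅q, ⁅p, w⁆⁆) (hgE : Commute ⁅p, q⁆ ⁅p, w⁆)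
    (hgA : Commute ⁅p, q⁆ ⁅q, w⁆) :
    ⁅⁅p, q⁆, w⁆ = ⁅p, ⁅q, w⁆⁆ * ⁅q, ⁅p, w⁆⁆⁻¹ * ⁅⁅p, w⁆⁻¹, ⁅q, w⁆⁻¹⁆⁻¹ := by
  have h1 : p * q * w * (p * q)⁻¹ = ⁅p, ⁅q, w⁆⁆ * ⁅q, w⁆ * ⁅p, w⁆ * w := by
    simp only [commutatorElement_def]; group
  have h2 : q * p * w * (q * p)⁻¹ = ⁅q, ⁅p, w⁆⁆ * ⁅p, w⁆ * ⁅q, w⁆ * w := by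
    simp only [commutatorElement_def]; group
  have h3 : ⁅p, q⁆ * (q * p * w * (q * p)⁻¹) * ⁅p, q⁆⁻¹ = p * q * w * (p * q)⁻¹ := by
    simp only [commutatorElement_def]; group
  rw [h1, h2] at h3
  generalize ⁅p, q⁆ = g at *
  generalize ⁅q, ⁅p, w⁆⁆ = Z at *
  generalize ⁅p, ⁅q, w⁆⁆ = U at *
  generalize ⁅p, w⁆ = E at *
  generalize ⁅q, w⁆ = A at *
  have h4 : g * (Z * E * A * w) * g⁻¹ = Z * E * A * ⁅g, w⁆ * w := by
    have : Commute g (Z * E * A) := (hgZ.mul_right hgE).mul_right hgA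
    rw [← mul_assoc, this.eq, commutatorElement_def]; group
  rw [h4, mul_left_inj] at h3
  have h5 : U * A * E = Z * E * A * (U * Z⁻¹ * ⁅E⁻¹, A⁻¹⁆⁻¹) := by
    have c1 : Commute (Z * E * A) (U * Z⁻¹) :=
      ((((hZU.mul_left hUE.symm).mul_left hUA.symm)).mul_right
        (((Commute.refl Z).mul_left hZE.symm).mul_left hZA.symm).inv_right)
    rw [← mul_assoc (Z * E * A), c1.eq, commutatorElement_def]; group
  rw [h5] at h3
  exact mul_left_cancel h3

/-- Lifts `sh i j ξ b` of the elements `X_{-j}((u, -ā) ↼ b)`, `ξ = (u, a)`, by means of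
commutators with `X_i(ξ)`. -/
structure PreShortLift (e : H →* G) (X : Idx n → Idx n → R → G)
    (Y : Idx n → L.toAddSubgroup → G) (x : Idx n → Idx n → R → H)
    (sh : Idx n → Idx n → L.toAddSubgroup → R → H) : Prop where
  map : ∀ {i j} (ξ b), D i j → e (sh i j ξ b) = Y (-j) (L.actL (L.conj ξ) b)
  comm : ∀ {i j} (ξ : L.toAddSubgroup) (b), D i j → ∀ {p q}, e p = Y i ξ → e q = X (-i) j b →
    ⁅p, q⁆ = x i j (sgn J i * ξ.1.scal * b) * sh i j ξ b

theorem Setup.exists_preShortLift (S : Setup L e X Y) (hx : LongLift (J := J) e X x) :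
    ∃ sh, PreShortLift e X Y x sh := by
  choose s es using S.central.surjective
  refine ⟨fun i j ξ b => (x i j (sgn J i * ξ.1.scal * b))⁻¹ * ⁅s (Y i ξ), x (-i) j b⁆, ⟨?_, ?_⟩⟩
  · intro i j ξ b h
    rw [map_mul, map_inv, map_commutatorElement, es, hx.map _ h, hx.map b h.negl, S.rel.r8 ξ b h,
      inv_mul_cancel_left]
  · intro i j ξ b h p q hp hq
    rw [mul_inv_cancel_left]
    exact S.central.commutator_congr (hp.trans (es _).symm) (hq.trans (hx.map b h.negl).symm)

variable {sh : Idx n → Idx n → L.toAddSubgroup → R → H}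

/-- Expand [PQ, W] as P[Q, W]P⁻¹ · [P, W]. By the lifted R6, conjugation by P contributes exactly
the cross term B(u, v)b of the Heisenberg law. The order of the factors reverses, as it does for
`conj`. -/
theorem PreShortLift.add (hs : PreShortLift e X Y x sh) (S : Setup L e X Y)
    (hx : LongLift (J := J) e X x) {i j : Idx n} (h : D i j) (ξ ζ : L.toAddSubgroup) (b : R) :
    sh i j (ξ + ζ) b = sh i j ζ b * sh i j ξ b := by
  obtain ⟨P, hP⟩ := S.central.surjective (Y i ξ)
  obtain ⟨Q, hQ⟩ := S.central.surjective (Y i ζ)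
  have hW := hx.map b h.negl
  have hPQ : e (P * Q) = Y i (ξ + ζ) := by rw [map_mul, hP, hQ, S.rel.r2]
  have h1 := hs.comm (ξ + ζ) b h hPQ hW
  have c0 : ∀ c, Commute (sh i j ζ b) (x i j c) := fun c =>
    hx.commute_short S (hs.map ζ b h) c h (by simpa using h.1) j.ne_neg
  have h2 : P * sh i j ζ b * P⁻¹ = x i j (sgn J i * B ξ.1.vec (ζ.1.vec <• b)) * sh i j ζ b := by
    have := hx.commutator_short S h.negr hP (hs.map ζ b h)
    rw [neg_neg, OddFormParameter.actL_vec, OddFormParameter.conj_vec] at this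
    rw [← this, commutatorElement_def, inv_mul_cancel_right]
  have h3 : P * x i j (sgn J i * ζ.1.scal * b) * P⁻¹ = x i j (sgn J i * ζ.1.scal * b) :=
    commute_conj (hx.commute_short S hP _ h i.ne_neg h.symm.1)
  have h4 : B ξ.1.vec (ζ.1.vec <• b) = B ξ.1.vec ζ.1.vec * b := by
    have := B.map_smul ξ.1.vec ζ.1.vec 1 b
    simpa [J.bar_one] using this
  rw [commutator_mul_left, hs.comm ζ b h hQ hW, hs.comm ξ b h hP hW] at h1
  have h5 : ∀ a b : H, P * (a * b) * P⁻¹ = P * a * P⁻¹ * (P * b * P⁻¹) := fun a b => by group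
  rw [h5, h2, h3, h4] at h1
  have h7 : ∀ a b c d f : H, Commute d c → a * (b * d) * (c * f) = a * b * c * (d * f) :=
    fun a b c d f hdc => by
      calc a * (b * d) * (c * f) = a * b * (d * c) * f := by group
        _ = _ := by rw [hdc.eq]; group
  rw [h7 _ _ _ _ _ (c0 _), hx.add _ _ h, hx.add _ _ h] at h1
  have h6 : sgn J i * ζ.1.scal * b + sgn J i * (B ξ.1.vec ζ.1.vec * b) + sgn J i * ξ.1.scal * b =
      sgn J i * (ξ + ζ).1.scal * b := by
    rw [AddSubgroup.coe_add, Heisenberg.add_scal]; noncomm_ring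
  rw [h6] at h1
  exact (mul_left_cancel h1).symm

/-- Write x_{-i,j}(bd) as [x_{-i,k}(b), x_{kj}(d)] and conjugate by a lift P of X_i(ξ), which
commutes with x_{kj}(d). Computing both sides gives `sh` with first index i on one side and -k on
the other; moving x_{-i,j}(bd) past x_{ij}(A) leaves the trace factor. -/
theorem PreShortLift.twist (hs : PreShortLift e X Y x sh) (S : Setup L e X Y)
    (hx : LongLift (J := J) e X x) (hT : TraceLift L e X Y T) {i j k : Idx n}
    (hij : D i j) (hik : D i k) (hkj : D k j) (ξ : L.toAddSubgroup) (b d : R) :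
    sh i j ξ (b * d) = sh (-k) j (L.actL (L.conj ξ) b) d *
      T (-j) (-(J.bar (b * d) * (↑J.oneBar⁻¹ : R) * ξ.1.scal * (b * d))) := by
  obtain ⟨P, hP⟩ := S.central.surjective (Y i ξ)
  have hy := hx.map b hik.negl
  have hz := hx.map d hkj
  have hW := hx.map (b * d) hij.negl
  set A := sgn J i * ξ.1.scal * (b * d) with hA
  set E := sgn J i * ξ.1.scal * b with hE
  set W' := sgn J (-j) * J.bar (b * d) * sgn J (-i) with hW'
  set Γ := sgn J (-k) * (L.actL (L.conj ξ) b).1.scal * d with hΓ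
  have hyz : ⁅x (-i) k b, x k j d⁆ = x (-i) j (b * d) :=
    hx.comm b d hik.negl hkj hij.negl hy hz
  have hPy : ⁅P, x (-i) k b⁆ = x i k E * sh i k ξ b := hs.comm ξ b hik hP hy
  have hPW : ⁅P, x (-i) j (b * d)⁆ = x i j A * sh i j ξ (b * d) := hs.comm ξ _ hij hP hW
  have hWflip : x (-i) j (b * d) = x (-j) i W' := by
    rw [hx.flip _ hij.negl, neg_neg]
  have hsh := hs.map ξ b hik
  have hsh2 := hs.map (L.actL (L.conj ξ) b) d hkj.negl
  have hPz : Commute P (x k j d) := hx.commute_short S hP d hkj hik.symm.2 hij.symm.1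
  have main := conj_commutator_of_commute (y := x (-i) k b) hPz
  have h1 : ⁅sh i k ξ b, x k j d⁆ = x (-k) j Γ * sh (-k) j (L.actL (L.conj ξ) b) d :=
    hs.comm _ d hkj.negl hsh (by rw [hx.map d hkj, neg_neg])
  have h2 : ⁅x i k E * sh i k ξ b, x k j d⁆ =
      x (-k) j Γ * sh (-k) j (L.actL (L.conj ξ) b) d * x i j A := by
    rw [commutator_mul_left, h1, commute_conj, hx.comm E d hik hkj hij (hx.map E hik) hz, hE, hA,
      mul_assoc _ b d]
    exact (hx.commute_long S _ _ hik hkj.negl k.neg_ne hik.neg.symm.1 hij.symm.1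
      hkj.symm.2).mul_right (hx.commute_short S hsh2 E hik (by simpa using hij.1) hkj.2).symm
  have h3 : x i k E * sh i k ξ b * x (-i) j (b * d) * (x i k E * sh i k ξ b)⁻¹ =
      (x (-j) k (W' * E))⁻¹ * x (-i) j (b * d) := by
    have c1 := hx.commute_short S hsh (b * d) hij.negl (by simpa using hik.negl.1) hkj.symm.2
    have h := hx.comm W' E hij.symm.negl hik hkj.symm.negl (hx.map W' hij.symm.negl)
      (hx.map E hik)
    rw [← h, commutatorElement_inv, ← hWflip, commutatorElement_def]
    have : sh i k ξ b * x (-i) j (b * d) * (sh i k ξ b)⁻¹ = x (-i) j (b * d) := commute_conj c1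
    calc _ = x i k E * (sh i k ξ b * x (-i) j (b * d) * (sh i k ξ b)⁻¹) * (x i k E)⁻¹ := by group
      _ = _ := by rw [this]; group
  -- The two extra long factors agree by the lifted R0, so they cancel after reordering.
  have h4 : x (-j) k (W' * E) = x (-k) j Γ := by
    rw [hx.flip Γ hkj.negl, neg_neg]
    congr 1
    have hc := sgn_mul_sgn_neg J (-i)
    rw [neg_neg] at hc
    calc W' * E = sgn J (-j) * J.bar (b * d) * (sgn J (-i) * sgn J i) * ξ.1.scal * b := by
          rw [hW', hE]; noncomm_ring
      _ = -(sgn J (-j) * (J.bar d * (↑J.oneBar⁻¹ : R) * J.bar b * (↑J.oneBar⁻¹ : R)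
            * ξ.1.scal * b)) := by rw [hc, J.bar_mul]; noncomm_ring
      _ = -(sgn J (-j) * (J.bar d * (↑J.oneBar⁻¹ : R) * J.bar b * (↑J.oneBar⁻¹ : R)
            * ξ.1.scal * b)) * ((↑J.oneBar⁻¹ : R) * J.bar (sgn J (-k)) * sgn J (-k)) := by
          rw [oneBar_inv_mul_bar_sgn, mul_one]
      _ = _ := by
          rw [hΓ, OddFormParameter.actL_scal, OddFormParameter.conj_scal]
          simp [J.bar_mul, J.bar_bar, J.bar_oneBar_inv, mul_assoc]
  rw [hPy, hyz, h2, h3, h4] at main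
  have h5 : P * x (-i) j (b * d) * P⁻¹ = x i j A * sh i j ξ (b * d) * x (-i) j (b * d) := by
    rw [← hPW, commutatorElement_def, inv_mul_cancel_right]
  rw [h5] at main
  have c1 : Commute (x (-i) j (b * d)) (x (-k) j Γ) :=
    hx.commute_long S _ _ hij.negl hkj.negl hkj.negl.1
      (by simpa using hik.symm.negl.1) hij.symm.2 j.ne_neg
  have c2 : Commute (sh (-k) j (L.actL (L.conj ξ) b) d) (x (-i) j (b * d)) :=
    hx.commute_short S hsh2 _ hij.negl (by simpa using hij.negl.1) j.ne_neg
  have hcom : ⁅x (-i) j (b * d), x i j A⁆ =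
      T (-j) (-(J.bar (b * d) * (↑J.oneBar⁻¹ : R) * ξ.1.scal * (b * d))) := by
    rw [hT.comm W' A hij.symm.negl (by rw [hWflip, hx.map W' hij.symm.negl])
      (by rw [hx.map A hij, neg_neg]), neg_neg]
    congr 2
    have g1 := sgn_mul_oneBar_mul_sgn_neg J j
    have g2 := sgn_mul_sgn_neg J (-i)
    rw [neg_neg] at g2
    calc sgn J j * J.oneBar * W' * A = sgn J j * (J.oneBar * sgn J (-j)) * J.bar (b * d) *
          (sgn J (-i) * sgn J i) * ξ.1.scal * (b * d) := by rw [hW', hA]; noncomm_ring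
      _ = _ := by rw [g1, g2]; noncomm_ring
  have c3 : Commute (x i j A) (sh (-k) j (L.actL (L.conj ξ) b) d * ⁅x (-i) j (b * d), x i j A⁆) :=
    ((hx.commute_short S hsh2 A hij (by simpa using hij.1) j.ne_neg).symm).mul_right
      (hx.commute_short S (by rw [hcom, hT.map]) A hij (by simpa using hij.1) j.ne_neg).symm
  rw [← hcom]
  refine mul_left_cancel (a := x i j A) (mul_right_cancel (b := x (-i) j (b * d)) ?_)
  rw [main, c3.eq]
  generalize x (-i) j (b * d) = w at *
  generalize x (-k) j Γ = g at *
  generalize sh (-k) j (L.actL (L.conj ξ) b) d = q at *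
  generalize x i j A = r at *
  calc g⁻¹ * w * (g * q * r) = g⁻¹ * (w * g) * q * r := by group
    _ = w * q * r := by rw [c1.eq]; group
    _ = q * w * r := by rw [c2.eq]
    _ = _ := by rw [commutatorElement_def]; group

end ShortLifts

/-! ### The Steinberg relations in H -/

section LiftedRelations

variable {R : Type u} [Ring R] {J : PseudoInvolution R} {V : Type v} [AddCommGroup V]
  [Module Rᵐᵒᵖ V] {B : AntiHermitianForm J V} {n : ℕ} {L : OddFormParameter B}
  {H G : Type*} [Group H] [Group G]

variable {e : H →* G} {X : Idx n → Idx n → R → G} {Y : Idx n → L.toAddSubgroup → G}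
  {x : Idx n → Idx n → R → H} {T : Idx n → R → H}

/-- The commutator of `T i c` with `x_{-i,j}(1)`. -/
theorem TraceLift.commutator_long (S : Setup L e X Y) (hx : LongLift (J := J) e X x)
    (hT : TraceLift L e X Y T) {i j : Idx n} (hij : D i j) (c : R) :
    ⁅T i c, x (-i) j 1⁆ = x i j (sgn J i * (L.tr c).1.scal * 1) * T (-j) (-c) := by
  obtain ⟨k, dki, dkj⟩ := exists_D_of_three_le (le_trans (by norm_num) S.four) i j
  set a := sgn J i * c with ha
  set β := sgn J (-j) * J.bar 1 * sgn J (-i) with hβ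
  have hp := hx.map a dki.symm
  have hq := hx.map 1 dki.negr
  have hw := hx.map 1 hij.negl
  have hpq : ⁅x i k a, x k (-i) 1⁆ = T i c := by
    rw [hT.comm a 1 dki.symm hp hq]
    congr 1
    have h := sgn_neg_mul_oneBar_mul_sgn J i
    calc _ = -((sgn J (-i) * (J.oneBar * sgn J i)) * c) := by rw [ha]; noncomm_ring
      _ = c := by rw [h]; simp
  have hwflip : x (-i) j 1 = x (-j) i β := by rw [hx.flip _ hij.negl, neg_neg]
  have hqw : ⁅x k (-i) 1, x (-i) j 1⁆ = x k j 1 := by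
    rw [hx.comm 1 1 dki.negr hij.negl dkj hq hw, mul_one]
  have hwp : ⁅x (-j) i β, x i k a⁆ = x (-j) k (β * a) :=
    hx.comm β a hij.symm.negl dki.symm dkj.symm.negl (hx.map _ hij.symm.negl) hp
  have hpw : ⁅x i k a, x (-i) j 1⁆ = x (-j) k (-(β * a)) := by
    rw [hwflip, ← commutatorElement_inv, hwp, hx.inv dkj.symm.negl]
  have hU : ⁅x i k a, x k j 1⁆ = x i j a := by
    rw [hx.comm a 1 dki.symm dkj hij hp (hx.map 1 dkj), mul_one]
  have hZ : ⁅x k (-i) 1, x (-j) k (-(β * a))⁆ = x (-j) (-i) (β * a) := by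
    rw [← commutatorElement_inv, hx.comm (-(β * a)) 1 dkj.symm.negl dki.negr hij.symm.neg
      (hx.map _ dkj.symm.negl) hq, hx.inv hij.symm.neg, mul_one, neg_neg]
  have hZ' : x (-j) (-i) (-(β * a)) = x i j (sgn J i * J.bar c) := by
    rw [hx.flip _ hij.symm.neg]
    simp only [neg_neg]
    congr 1
    have h1 : β * a = -(sgn J (-j) * c) := by
      have h := sgn_mul_sgn_neg J (-i)
      rw [neg_neg] at h
      calc β * a = sgn J (-j) * J.oneBar * (sgn J (-i) * sgn J i) * c := by
            rw [hβ, ha, J.bar_one]; noncomm_ring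
        _ = _ := by rw [h]; simp [mul_assoc]
    rw [h1, neg_neg, J.bar_mul]
    calc _ = sgn J i * J.bar c * ((↑J.oneBar⁻¹ : R) * J.bar (sgn J (-j)) * sgn J (-j)) := by
          noncomm_ring
      _ = _ := by rw [oneBar_inv_mul_bar_sgn, mul_one]
  have hEA : ⁅x (-j) k (β * a), x k j (-1)⁆⁻¹ = T (-j) (-c) := by
    rw [hT.comm (β * a) (-1) dkj.symm.negl (hx.map _ dkj.symm.negl)
      (by rw [hx.map _ dkj, neg_neg]), hT.inv]
    congr 1
    rw [neg_neg j, neg_neg]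
    have h1 := sgn_mul_oneBar_mul_sgn_neg J j
    have h2 := sgn_neg_mul_oneBar_mul_sgn J i
    calc _ = -((sgn J j * (J.oneBar * sgn J (-j))) * (J.oneBar * sgn J (-i) * sgn J i * c)) := by
          rw [hβ, ha, J.bar_one]; noncomm_ring
      _ = sgn J (-i) * (J.oneBar * sgn J i) * c := by
          rw [h1, oneBar_mul_sgn]; noncomm_ring
      _ = _ := by rw [h2]; noncomm_ring
  have hg : e ⁅x i k a, x k (-i) 1⁆ = Y i (L.tr c) := by rw [hpq, hT.map]
  -- T i c is now the commutator of p and q, so its bracket with w reduces to long commutators: the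
  -- first two factors give x_ij(ε_i c) and x_ij(ε_i c̄), the last one gives the trace factor.
  have key := commutator_commutator_left (p := x i k a) (q := x k (-i) 1) (w := x (-i) j 1)
  rw [hqw, hpw, hU, hZ] at key
  rw [← hpq, key]
  · rw [hx.inv hij.symm.neg, hZ', hx.inv dkj.symm.negl, hx.inv dkj, neg_neg, hEA,
      hx.add _ _ hij, OddFormParameter.tr_scal, mul_one, mul_add, ha]
  · exact hx.commute_long S _ _ hij.symm.neg dkj.symm.negl hij.symm.neg.1 (by simpa using j.neg_ne)
      dkj.2 dki.negr.2
  · exact hx.commute_long S _ _ hij.symm.neg dkj dki.2 (by simpa using dkj.1) j.ne_neg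
      (by simpa using hij.symm.1)
  · exact hx.commute_long S _ _ hij.symm.neg hij i.ne_neg (by simpa using hij.1) j.ne_neg
      (by simpa using hij.symm.1)
  · exact hx.commute_long S _ _ hij dkj dkj.1 dki.2 hij.symm.1 j.ne_neg
  · exact hx.commute_long S _ _ hij dkj.symm.negl j.neg_ne hij.symm.neg.1 dki.1 dkj.2
  · exact hx.commute_short S hg _ hij.symm.neg hij.symm.neg.1 i.neg_ne
  · exact hx.commute_short S hg _ dkj.symm.negl hij.symm.neg.1 dki.1
  · exact hx.commute_short S hg _ dkj dki.2 hij.symm.1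

/-- The Steinberg relations lift along a central extension. -/
theorem Setup.exists_lift (S : Setup L e X Y) :
    ∃ (x : Idx n → Idx n → R → H) (y : Idx n → L.toAddSubgroup → H), SteinbergRel L x y ∧
      (∀ i j a, D i j → e (x i j a) = X i j a) ∧ ∀ i ξ, e (y i ξ) = Y i ξ := by
  obtain ⟨x, hx⟩ := S.exists_longLift
  obtain ⟨T, hT⟩ := S.exists_traceLift hx
  obtain ⟨sh, hs⟩ := S.exists_preShortLift hx
  choose c hc _ using fun i : Idx n =>
    exists_D_of_three_le (le_trans (by norm_num) S.four) i i
  -- With b = d = 1 the right side of `twist` does not involve i, once k avoids i, j and l.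
  have indep : ∀ {i j l} (ξ : L.toAddSubgroup), D i j → D l j → sh i j ξ 1 = sh l j ξ 1 := by
    intro i j l ξ hij hlj
    obtain ⟨k, d1, d2, d3⟩ := exists_D S.four i j l
    have h1 := hs.twist S hx hT hij d1.symm d2 ξ 1 1
    have h2 := hs.twist S hx hT hlj d3.symm d2 ξ 1 1
    rw [mul_one] at h1 h2
    rw [h1, h2]
  -- Forming `sh` applies `conj`, so it is fed conj ξ in order to lie over X_i(ξ).
  set y : Idx n → L.toAddSubgroup → H := fun i ξ => sh (c i) (-i) (L.conj ξ) 1 with hy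
  have sh_one : ∀ {i j} (ξ : L.toAddSubgroup), D i j → sh i j ξ 1 = y (-j) (L.conj ξ) := by
    intro i j ξ hij
    simp only [hy, OddFormParameter.conj_conj]
    rw [neg_neg]
    exact indep ξ hij (by simpa using (hc (-j)).negr)
  -- `twist` with b = d = 1, both sides rewritten through y.
  have y_conj : ∀ i (ξ : L.toAddSubgroup), y i (L.conj ξ) = y i ξ * T i (-ξ.1.scal) := by
    intro i ξ
    obtain ⟨k, d1, d2⟩ := exists_D_of_three_le (le_trans (by norm_num) S.four) i (c i)
    have h := hs.twist S hx hT (hc i).negr d2.symm d1.negr ξ 1 1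
    rw [mul_one, OddFormParameter.actL_one, sh_one _ (hc i).negr, sh_one _ d1.neg,
      OddFormParameter.conj_conj, neg_neg, J.bar_one] at h
    simpa using h
  -- `twist` with d = 1 absorbs b into the parameter, and `y_conj` cancels the trace factor.
  have r8 : ∀ {i j} (ξ : L.toAddSubgroup) (b), D i j →
      sh i j ξ b = y (-j) (L.actL (L.conj ξ) b) := by
    intro i j ξ b hij
    obtain ⟨k, d1, d2⟩ := exists_D_of_three_le (le_trans (by norm_num) S.four) i j
    have h := hs.twist S hx hT hij d1.symm d2 ξ b 1
    rw [mul_one, sh_one _ d2.negl, OddFormParameter.conj_actL, OddFormParameter.conj_conj] at h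
    rw [h, ← OddFormParameter.conj_actL, y_conj, OddFormParameter.actL_scal]
  have y_map : ∀ i ξ, e (y i ξ) = Y i ξ := by
    intro i ξ
    rw [hy]
    dsimp only
    rw [hs.map _ _ (hc i).negr, OddFormParameter.conj_conj, OddFormParameter.actL_one, neg_neg]
  have y_add : ∀ i ξ ζ, y i ξ * y i ζ = y i (ξ + ζ) := by
    intro i ξ ζ
    rw [hy]
    dsimp only
    rw [OddFormParameter.conj_add, hs.add S hx (hc i).negr]
  -- Two evaluations of the commutator of a trace lift with x_{-j,k}-type long elements, by R8 and
  -- by Hall–Witt, have the same long factor; cancelling it identifies T with y, as R9 requires.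
  have y_tr : ∀ i r, y i (L.tr r) = T i r := by
    intro i r
    have d : D (c i) (-i) := (hc i).negr
    have h1 := hT.commutator_long S hx d (-r)
    rw [hs.comm _ 1 d (hT.map _ _) (hx.map 1 d.negl), sh_one _ d, neg_neg, neg_neg] at h1
    rw [← mul_left_cancel h1]
    congr 1
    refine OddFormParameter.ext_param rfl ?_
    simp [J.bar_bar, add_comm]
  refine ⟨x, y, ⟨hx.flip, hx.add, y_add, ?_, ?_, ?_, ?_, ?_, ?_⟩, fun i j a h => hx.map a h, y_map⟩
  · exact fun a b hij hhk h1 h2 h3 h4 => hx.commute_long S a b hij hhk h1 h2 h3 h4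
  · exact fun ξ a hjk h1 h2 => hx.commute_short S (y_map _ _) a hjk h1 h2
  · exact fun a b h1 h2 h3 => hx.comm a b h1 h2 h3 (hx.map a h1) (hx.map b h2)
  · exact fun ξ ζ h => hx.commutator_short S h (y_map _ _) (y_map _ _)
  · intro i j ξ b h
    rw [hs.comm ξ b h (y_map _ _) (hx.map b h.negl), r8 ξ b h]
  · intro i j a b h
    rw [hT.comm a b h (hx.map a h) (hx.map b h.symm.negr), y_tr]

end LiftedRelations

/-! ### From lifted relations to the section -/

section Splitting

variable {R : Type u} [Ring R] {J : PseudoInvolution R} {V : Type v} [AddCommGroup V]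
  [Module Rᵐᵒᵖ V] {B : AntiHermitianForm J V} {n : ℕ} (L : OddFormParameter B)

/-- The second summand in R9 is the conjugate of the first, as a check of both signs of i shows. -/
theorem OddFormParameter.short_eq_tr (i : Idx n) (a b : R) :
    (⟨⟨0, -(sgn J (-i) * J.oneBar * a * b) +
          J.bar b * (↑J.oneBar⁻¹ : R) * J.bar a * sgn J i⟩, L.short_mem i a b⟩ : L.toAddSubgroup) =
      L.tr (-(sgn J (-i) * J.oneBar * a * b)) := by
  refine OddFormParameter.ext_param rfl ?_
  simp only [OddFormParameter.tr_scal, add_right_inj]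
  rcases sgn_cases J i with ⟨h1, h2⟩ | ⟨h1, h2⟩ <;> rw [h1, h2] <;>
    simp [J.bar_mul, J.bar_oneBar, mul_assoc]

namespace StU

/-- The element `X_ij(a)`, extended by `1` to all pairs of indices. -/
noncomputable def totX (i j : Idx n) (a : R) : StU L n :=
  open Classical in if h : D i j then X L i j h a else 1

theorem totX_eq {i j : Idx n} (h : D i j) (a : R) : totX L i j a = X L i j h a := dif_pos h

theorem mk_commutator (x y : FreeGroup (Gen L n)) :
    PresentedGroup.mk (relators L n) ⁅x, y⁆ =
      ⁅PresentedGroup.mk (relators L n) x, PresentedGroup.mk (relators L n) y⁆ :=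
  map_commutatorElement _ x y

theorem steinbergRel : SteinbergRel L (totX L (n := n)) (Y L) where
  r0 {i j} a h := by
    rw [totX_eq L h, totX_eq L h.symm.neg]
    exact mk_eq_of_rel L (Rel.r0 i j h h.symm.neg a)
  r1 {i j} a b h := by
    rw [totX_eq L h, totX_eq L h, totX_eq L h]
    exact mk_eq_of_rel L (Rel.r1 i j h a b)
  r2 i ξ ζ := mk_eq_of_rel L (Rel.r2 i ξ ζ)
  r3 {i j h k} a b hij hhk h1 h2 h3 h4 := by
    rw [totX_eq L hij, totX_eq L hhk, ← commutatorElement_eq_one_iff_commute]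
    exact (mk_commutator L _ _).symm.trans
      (mk_eq_of_rel L (Rel.r3 i j h k hij hhk ⟨h1, h2⟩ ⟨h3, h4⟩ a b))
  r4 {i j k} ξ a hjk h1 h2 := by
    rw [totX_eq L hjk, ← commutatorElement_eq_one_iff_commute]
    exact (mk_commutator L _ _).symm.trans (mk_eq_of_rel L (Rel.r4 i j k hjk h1 h2 ξ a))
  r5 {i j k} a b h1 h2 h3 := by
    rw [totX_eq L h1, totX_eq L h2, totX_eq L h3]
    exact (mk_commutator L _ _).symm.trans (mk_eq_of_rel L (Rel.r5 i j k h1 h2 h3 a b))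
  r6 {i j} ξ ζ h := by
    rw [totX_eq L h.negr]
    exact (mk_commutator L _ _).symm.trans (mk_eq_of_rel L (Rel.r6 i j h.negr ξ ζ))
  r8 {i j} ξ b h := by
    rw [totX_eq L h.negl, totX_eq L h]
    exact (mk_commutator L _ _).symm.trans (mk_eq_of_rel L (Rel.r8 i j h h.negl ξ b))
  r9 {i j} a b h := by
    rw [totX_eq L h, totX_eq L h.symm.negr, ← L.short_eq_tr]
    exact (mk_commutator L _ _).symm.trans (mk_eq_of_rel L (Rel.r9 i j h h.symm.negr a b))

variable {L} {K : Type*} [Group K] {X' : Idx n → Idx n → R → K} {Y' : Idx n → L.toAddSubgroup → K}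

/-- The images of the generators under the homomorphism defined by Steinberg elements. -/
def genLift (X' : Idx n → Idx n → R → K) (Y' : Idx n → L.toAddSubgroup → K) : Gen L n → K
  | .long i j _ a => X' i j a
  | .short i ξ => Y' i ξ

theorem lift_gl (i j : Idx n) (h : D i j) (a : R) :
    FreeGroup.lift (genLift X' Y') (gl L i j h a) = X' i j a := FreeGroup.lift_apply_of ..

theorem lift_gs (i : Idx n) (ξ : L.toAddSubgroup) :
    FreeGroup.lift (genLift X' Y') (gs L i ξ) = Y' i ξ := FreeGroup.lift_apply_of ..

theorem lift_rel (h : SteinbergRel L X' Y') {x y : FreeGroup (Gen L n)} (hr : Rel L n x y) :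
    FreeGroup.lift (genLift X' Y') x = FreeGroup.lift (genLift X' Y') y := by
  cases hr with
  | r0 i j hij hji a => simpa only [lift_gl] using h.r0 a hij
  | r1 i j hij a b => simpa only [map_mul, lift_gl] using h.r1 a b hij
  | r2 i ξ ζ => simpa only [map_mul, lift_gs] using h.r2 i ξ ζ
  | r3 i j k l hij hkl h1 h2 a b =>
    simpa only [map_commutatorElement, lift_gl, map_one] using
      commutatorElement_eq_one_iff_commute.2 (h.r3 a b hij hkl h1.1 h1.2 h2.1 h2.2)
  | r4 i j k hjk h1 h2 ξ a =>
    simpa only [map_commutatorElement, lift_gl, lift_gs, map_one] using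
      commutatorElement_eq_one_iff_commute.2 (h.r4 ξ a hjk h1 h2)
  | r5 i j k hij hjk hik a b =>
    simpa only [map_commutatorElement, lift_gl] using h.r5 a b hij hjk hik
  | r6 i j hij ξ ζ =>
    simpa only [map_commutatorElement, lift_gl, lift_gs] using
      h.r6 ξ ζ (by simpa using D.negr hij : D i j)
  -- R7 follows from R2 and the commutator in the Heisenberg group, so `SteinbergRel` does not list
  -- it.
  | r7 i ξ ζ =>
    simp only [map_commutatorElement, lift_gs]
    rw [commutatorElement_def, mul_inv_eq_iff_eq_mul, mul_inv_eq_iff_eq_mul, mul_assoc, h.r2, h.r2,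
      h.r2]
    congr 1
    exact OddFormParameter.ext_param (by simp [add_comm]) (by simp; abel)
  | r8 i j hij hij' ξ b =>
    simp only [map_commutatorElement, map_mul, lift_gl, lift_gs]
    exact h.r8 ξ b hij
  | r9 i j hij hji a b =>
    rw [L.short_eq_tr]
    simpa only [map_commutatorElement, lift_gl, lift_gs] using h.r9 a b hij

/-- The homomorphism to a group with elements that satisfy the Steinberg relations. -/
def ofRel (h : SteinbergRel L X' Y') : StU L n →* K :=
  PresentedGroup.toGroup (f := genLift X' Y') (by
    rintro r ⟨x, y, hr, rfl⟩
    rw [map_mul, map_inv, lift_rel h hr, mul_inv_cancel])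

theorem ofRel_X (h : SteinbergRel L X' Y') (i j : Idx n) (hij : D i j) (a : R) :
    ofRel h (X L i j hij a) = X' i j a := PresentedGroup.toGroup.of _

theorem ofRel_Y (h : SteinbergRel L X' Y') (i : Idx n) (ξ : L.toAddSubgroup) :
    ofRel h (Y L i ξ) = Y' i ξ := PresentedGroup.toGroup.of _

theorem hom_ext {f g : StU L n →* K} (h1 : ∀ i j (h : D i j) a, f (X L i j h a) = g (X L i j h a))
    (h2 : ∀ i ξ, f (Y L i ξ) = g (Y L i ξ)) : f = g := by
  refine PresentedGroup.ext ?_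
  rintro (⟨i, j, hij, a⟩ | ⟨i, ξ⟩)
  · exact h1 i j hij a
  · exact h2 i ξ

theorem splits {e : K →* StU L n} (hn : 4 ≤ n) (he : IsCentralExtension e)
    (h8 : ∀ (i j k h : Idx n) (hij : D i j) (hkh : D k h) (a b : R),
      D k i → D k j → D h i → D h j → LiftsCommute e (X L i j hij a) (X L k h hkh b)) :
    Splits e := by
  have S : Setup L e (totX L) (Y L) :=
    { rel := steinbergRel L
      central := he
      four := hn
      eight := fun {i j k h} a b hij hkh d1 d2 d3 d4 p q hp hq => by
        rw [totX_eq L hij] at hp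
        rw [totX_eq L hkh] at hq
        exact commutatorElement_eq_one_iff_commute.1
          (h8 i j k h hij hkh a b d1 d2 d3 d4 p q hp hq) }
  obtain ⟨x, y, hrel, hx, hy⟩ := S.exists_lift
  refine ⟨ofRel hrel, hom_ext ?_ ?_⟩
  · intro i j h a
    rw [MonoidHom.comp_apply, ofRel_X, hx i j a h, totX_eq L h, MonoidHom.id_apply]
  · intro i ξ
    rw [MonoidHom.comp_apply, ofRel_Y, hy, MonoidHom.id_apply]

/-- Since `StU(2n, R, 𝔏)` is perfect, lifts along central extensions are unique. -/
theorem lift_unique {G : Type*} [Group G] {e : K →* G} (he : IsCentralExtension e) (hn : 3 ≤ n)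
    {f g : StU L n →* K} (hfg : e.comp f = e.comp g) : f = g := by
  have hc : ∀ x y : StU L n, f ⁅x, y⁆ = g ⁅x, y⁆ := fun x y => by
    rw [map_commutatorElement, map_commutatorElement]
    exact he.commutator_congr (DFunLike.congr_fun hfg x) (DFunLike.congr_fun hfg y)
  have hX : ∀ {i j} (a), D i j → f (totX L i j a) = g (totX L i j a) := by
    intro i j a h
    obtain ⟨k, d1, d2⟩ := exists_D_of_three_le hn i j
    have := (steinbergRel L).r5 a 1 d1.symm d2 h
    rw [mul_one] at this
    rw [← this, hc]
  refine hom_ext ?_ ?_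
  · intro i j h a
    simpa only [totX_eq L h] using hX a h
  · intro i ξ
    obtain ⟨k, d, _⟩ := exists_D_of_three_le hn i i
    -- R8 presents Y_i(ξ) as a commutator up to a long element, on which f and g already agree.
    have h := (steinbergRel L).r8 (L.conj ξ) 1 d.negr
    rw [OddFormParameter.conj_conj, OddFormParameter.actL_one, neg_neg] at h
    have h' := hc (Y L k (L.conj ξ)) (totX L (-k) (-i) 1)
    rw [h, map_mul, map_mul, hX _ d.negr] at h'
    exact mul_left_cancel h'

end StU

/-! ### The stable case -/

namespace StUInf

variable {L}

/-- The canonical homomorphism from `StU(2n, R, 𝔏)` to the direct limit. -/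
noncomputable def of (n : Set.Ici 3) : StU L n.1 →* StUInf L where
  toFun x := ⟦⟨n, x⟩⟧
  map_one' := (DirectLimit.one_def n).symm
  map_mul' x y := (DirectLimit.mul_def (G := fun n : Set.Ici 3 => StU L n.1) (f := StU.sys L) n x y).symm

theorem of_sys {m n : Set.Ici 3} (h : m ≤ n) (x : StU L m.1) :
    of n (StU.sys L m n h x) = of m x := DirectLimit.mk_apply (F := fun n : Set.Ici 3 => StU L n.1) (f := StU.sys L) m n x h

/-- Splitting the pullback at each finite level gives lifts of the canonical maps into the limit;
uniqueness of such lifts makes them a compatible family. -/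
theorem splits {K : Type*} [Group K] {e : K →* StUInf L} (he : IsCentralExtension e)
    (h8 : ∀ (n : Set.Ici 3) (i j k h : Idx n.1) (hij : i ≠ j ∧ i ≠ -j)
      (hkh : k ≠ h ∧ k ≠ -h) (a b : R), EightDistinct i j k h →
        LiftsCommute e (StUInf.X L n i j hij a) (StUInf.X L n k h hkh b)) : Splits e := by
  have lift_four : ∀ n : Set.Ici 3, 4 ≤ n.1 → ∃ s : StU L n.1 →* K, e.comp s = of n := by
    intro n hn
    -- The fibre product of `e` and `of n`, a central extension of the finite group.
    let P : Subgroup (K × StU L n.1) :=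
      (e.comp (MonoidHom.fst _ _)).eqLocus ((of n).comp (MonoidHom.snd _ _))
    have hP : ∀ p : P, e p.1.1 = of n p.1.2 := fun p => p.2
    let f : P →* StU L n.1 := (MonoidHom.snd _ _).comp P.subtype
    have hf : IsCentralExtension f := by
      refine ⟨fun x => ?_, fun p hp => Subgroup.mem_center_iff.2 fun q => ?_⟩
      · obtain ⟨y, hy⟩ := he.surjective (of n x)
        exact ⟨⟨(y, x), hy⟩, rfl⟩
      · have h2 : p.1.2 = 1 := hp
        have h1 : p.1.1 ∈ Subgroup.center K :=
          he.ker_le_center (by rw [MonoidHom.mem_ker, hP p, h2, map_one])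
        refine Subtype.ext (Prod.ext (Subgroup.mem_center_iff.1 h1 q.1.1) ?_)
        change q.1.2 * p.1.2 = p.1.2 * q.1.2
        rw [h2, mul_one, one_mul]
    obtain ⟨s, hs⟩ := StU.splits hn hf (by
      intro i j k h hij hkh a b d1 d2 d3 d4 p q hp hq
      have hpX : p.1.2 = StU.X L i j hij a := hp
      have hqX : q.1.2 = StU.X L k h hkh b := hq
      refine Subtype.ext (Prod.ext ?_ ?_)
      · exact h8 n i j k h hij hkh a b (eightDistinct hij hkh d1 d2 d3 d4) p.1.1 q.1.1
          (by rw [hP, hpX]; rfl) (by rw [hP, hqX]; rfl)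
      -- The hypothesis controls only the coordinate in K; in the finite group the elements commute
      -- by R3.
      · change ⁅p.1.2, q.1.2⁆ = 1
        rw [hpX, hqX, commutatorElement_eq_one_iff_commute, ← StU.totX_eq L hij,
          ← StU.totX_eq L hkh]
        exact (StU.steinbergRel L).r3 a b hij hkh d2.1 d1.2 d3.1 d4.2)
    refine ⟨((MonoidHom.fst _ _).comp P.subtype).comp s, MonoidHom.ext fun x => ?_⟩
    exact (hP (s x)).trans (congrArg (of n) (DFunLike.congr_fun hs x))
  have lift_exists : ∀ n : Set.Ici 3, ∃ s : StU L n.1 →* K, e.comp s = of n := by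
    intro n
    have hn : 3 ≤ n.1 := n.2
    -- Level 3 is outside the finite theorem, so its lift is restricted from the next level.
    let m : Set.Ici 3 := ⟨n.1 + 1, Set.mem_Ici.2 (by omega)⟩
    have hnm : n ≤ m := Nat.le_succ n.1
    obtain ⟨s, hs⟩ := lift_four m (Nat.succ_le_succ hn)
    refine ⟨s.comp (StU.sys L n m hnm), MonoidHom.ext fun x => ?_⟩
    exact (DFunLike.congr_fun hs _).trans (of_sys hnm x)
  choose s hs using lift_exists
  have compat : ∀ m n (h : m ≤ n) x, s m x = s n (StU.sys L m n h x) := by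
    intro m n h
    refine DFunLike.congr_fun (f := s m) (g := (s n).comp (StU.sys L m n h)) ?_
    refine StU.lift_unique he m.2 (MonoidHom.ext fun x => ?_)
    exact (DFunLike.congr_fun (hs m) x).trans
      ((of_sys h x).symm.trans (DFunLike.congr_fun (hs n) _).symm)
  refine ⟨⟨⟨DirectLimit.lift (StU.sys L) (fun n => s n) compat, DirectLimit.lift_one _ compat⟩,
    DirectLimit.lift_mul _ compat⟩, MonoidHom.ext fun z => ?_⟩
  obtain ⟨n, x, rfl⟩ := DirectLimit.exists_eq_mk _ z
  exact DFunLike.congr_fun (hs n) x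

end StUInf

end Splitting

end OddUnitary

theorem mainTheorem2 {R : Type*} [Ring R] {J : OddUnitary.PseudoInvolution R}
    {V : Type*} [AddCommGroup V] [Module Rᵐᵒᵖ V] {B : OddUnitary.AntiHermitianForm J V}
    (L : OddUnitary.OddFormParameter B) {H : Type*} [Group H] :
    (∀ (n : ℕ) (e : H →* OddUnitary.StU L n), 4 ≤ n → OddUnitary.IsCentralExtension e →
      (∀ (i j k h : OddUnitary.Idx n) (hij : i ≠ j ∧ i ≠ -j) (hkh : k ≠ h ∧ k ≠ -h) (a b : R),
        OddUnitary.EightDistinct i j k h →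
          OddUnitary.LiftsCommute e (OddUnitary.StU.X L i j hij a)
            (OddUnitary.StU.X L k h hkh b)) →
      OddUnitary.Splits e) ∧
    (∀ e : H →* OddUnitary.StUInf L, OddUnitary.IsCentralExtension e →
      (∀ (n : Set.Ici 3) (i j k h : OddUnitary.Idx n.1) (hij : i ≠ j ∧ i ≠ -j)
        (hkh : k ≠ h ∧ k ≠ -h) (a b : R),
        OddUnitary.EightDistinct i j k h →
          OddUnitary.LiftsCommute e (OddUnitary.StUInf.X L n i j hij a)
            (OddUnitary.StUInf.X L n k h hkh b)) →
      OddUnitary.Splits e) :=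
  ⟨fun _ _ hn he h8 => OddUnitary.StU.splits hn he fun i j k h hij hkh a b d1 d2 d3 d4 =>
      h8 i j k h hij hkh a b (OddUnitary.eightDistinct hij hkh d1 d2 d3 d4),
    fun _ he h8 => OddUnitary.StUInf.splits he h8⟩
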